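/- Setting. An instance of a biobjective combinatorial optimization (BOCO) problem is a pair $(\mathcal S,C)$ with $\mathcal S\subseteq\{0,1\}^n$ and $C\in\mathbb Q^{2\times n}$ with rows $c_1,c_2$; a BOCO problem $P$ is a set of binary strings encoding such instances ($\mathcal S$ may be given implicitly), each string of length $O(n+\langle C\rangle)$, where $\langle\cdot\rangle$ is the binary encoding length. The input size is $n+\langle C\rangle$. The nondominated extreme points of $(\mathcal S,C)$ are the extreme points of the upper image $\{Cx \mid x\in\operatorname{conv}\mathcal S\}+\mathbb R^2_{\ge 0}$. For $\ell\in\mathbb Q^2$, $\ell\ge 0$, the lexicographic weighted-sum problem is to compute the point $y=Cx$ attaining $\operatorname{lexmin}\{(\ell^TCx,\,c_1x,\,c_2x)\mid x\in\mathcal S\}$, or to report that $\mathcal S=\emptyset$. The lexicographic version of $P$ is solvable in polynomial time if some algorithm solves all these problems in time polynomial in $n+\langle C\rangle+\langle\ell\rangle$. Algorithms are programs of a random access machine with unit-cost integer arithmetic and subroutine calls, whose words have a number of bits that is polynomial in the input size. Algorithm (variant of the Dichotomic Approach, using an algorithm $A$ for the lexicographic version as a subroutine). Solve the lexicographic weighted-sum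 problems for the weights $(1,0)$ and $(0,1)$, with optimal points $y^0$ and $y^1$. If $\mathcal S=\emptyset$, stop without output; if $y^0=y^1$, output this point and stop. Otherwise output $y^0$ and $y^1$ and examine the pair $(y^0,y^1)$. To examine a pair $(p,q)$ of points means: solve the lexicographic weighted-sum problem with weights $\lambda=(|p_2-q_2|,|p_1-q_1|)$ (multiplied by the denominators of the coordinates of $p$ and $q$, to make them integers), with optimal point $\bar y$; if $\bar y\notin\{p,q\}$, append the triple $(\bar y,p,q)$ to a first-in first-out queue. While the queue is not empty, remove its first triple $(y,y^2,y^3)$, output $y$, and examine the pairs $(y,y^2)$ and $(y,y^3)$. Statement. Let $P$ be a BOCO problem and let $A$ be an algorithm that solves the lexicographic version of $P$ in polynomial time. Then the above variant of the Dichotomic Approach with subroutine $A$ enumerates the nondominated extreme points of $P$ with polynomial delay: on every instance it terminates, it outputs every nondominated extreme point exactly once and nothing else, and the time before the first output, the time between any two consecutive outputs, and the time between the last output and termination (if there is no output, the total running time) are bounded by a polynomial in the input size $n+\langle C\rangle$. -/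

import Mathlib

/-! ### Encoding lengths -/

/-- The encoding length `1 + ⌈log₂ (|z| + 1)⌉` of an integer (which is `1` for `z = 0`). -/
def encInt (z : ℤ) : ℕ := 1 + Nat.clog 2 (z.natAbs + 1)

/-- The encoding length of a rational number in lowest terms. -/
def encRat (q : ℚ) : ℕ := encInt q.num + encInt (q.den : ℤ)

/-- The encoding length of a rational vector. -/
def encVec {n : ℕ} (v : Fin n → ℚ) : ℕ := n + ∑ i, encRat (v i)

/-- The encoding length of a rational matrix. -/
def encMat {m n : ℕ} (M : Matrix (Fin m) (Fin n) ℚ) : ℕ := m * n + ∑ i, encVec (M i)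

/-! ### Random access machines

A program works on registers and on an infinite memory whose cells hold integers. Programs are
written with structured control flow and may call subroutines. Every operation has unit cost, and
all integers that occur are restricted to `w` bits, where `w` is a parameter of the semantics. -/

namespace RAM

/-- The binary arithmetic operations of the machine. -/
inductive Op where
  | add | sub | mul | div | mod

/-- Integer quotient and remainder are the Euclidean ones. -/
def Op.apply : Op → ℤ → ℤ → ℤ
  | .add, a, b => a + b
  | .sub, a, b => a - b
  | .mul, a, b => a * b
  | .div, a, b => a / b
  | .mod, a, b => a % b

/-- Arithmetic expressions: constants, contents of registers, contents of the memory cell whose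
address is computed, and arithmetic operations. -/
inductive Exp where
  | const (z : ℤ)
  | reg (r : ℕ)
  | load (a : Exp)
  | op (o : Op) (a b : Exp)

instance (n : ℕ) : OfNat Exp n := ⟨.const n⟩
instance : Add Exp := ⟨.op .add⟩
instance : Sub Exp := ⟨.op .sub⟩
instance : Mul Exp := ⟨.op .mul⟩

/-- Programs. `ite e c d` and `loop e c` test whether the value of `e` is positive. `output es`
writes one output, consisting of the values of the expressions `es`. `call c src dst` runs `c` as a
subroutine (see `Exec`). -/
inductive Program where
  | skip
  | assign (r : ℕ) (e : Exp)
  | store (a e : Exp)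
  | output (es : List Exp)
  | seq (c d : Program)
  | ite (e : Exp) (c d : Program)
  | loop (e : Exp) (c : Program)
  | call (c : Program) (src dst : Exp)

/-- Sequential composition of a list of programs. -/
def Program.block (cs : List Program) : Program := cs.foldr .seq .skip

/-- A state of the machine: contents of registers and memory, the number of steps made so far, and
the outputs written so far, each with the time at which it was written. -/
structure State where
  reg : ℕ → ℤ
  mem : ℕ → ℤ
  clock : ℕ
  out : List (List ℤ × ℕ)

/-- The memory `m` after the list `v` has been written as a block at address `a`: first the length
of `v`, then its entries. -/
def writeBlock (m : ℕ → ℤ) (a : ℕ) (v : List ℤ) : ℕ → ℤ := fun i =>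
  if i = a then (v.length : ℤ)
  else if a < i ∧ i ≤ a + v.length then v.getD (i - (a + 1)) 0
  else m i

/-- The list stored as a block at address `a`. -/
def readBlock (m : ℕ → ℤ) (a : ℕ) : List ℤ :=
  (List.range (m a).toNat).map fun i => m (a + 1 + i)

/-- The initial state on the input `v`: `v` is stored as a block at address `0`, and all other cells
and all registers are `0`. -/
def State.start (v : List ℤ) : State where
  reg := fun _ => 0
  mem := writeBlock (fun _ => 0) 0 v
  clock := 0
  out := []

/-- The concatenation of all outputs of a state. -/
def State.result (s : State) : List ℤ := (s.out.map Prod.fst).flatten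

def State.tick (s : State) (t : ℕ) : State := { s with clock := s.clock + t }

def State.setReg (s : State) (r : ℕ) (z : ℤ) : State :=
  { s with reg := Function.update s.reg r z }

def State.setMem (s : State) (a : ℕ) (z : ℤ) : State :=
  { s with mem := Function.update s.mem a z }

/-- The value of an expression. Negative addresses are read as `0`. -/
def Exp.eval (s : State) : Exp → ℤ
  | .const z => z
  | .reg r => s.reg r
  | .load a => s.mem (a.eval s).toNat
  | .op o a b => o.apply (a.eval s) (b.eval s)

/-- The address computed by an expression. -/
def Exp.addr (s : State) (e : Exp) : ℕ := (e.eval s).toNat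

/-- The number of operations needed to evaluate an expression. -/
def Exp.cost : Exp → ℕ
  | .const _ => 1
  | .reg _ => 1
  | .load a => a.cost + 1
  | .op _ a b => a.cost + b.cost + 1

/-- The integer `z` has at most `w` bits. -/
def FitsWord (w : ℕ) (z : ℤ) : Prop := z.natAbs < 2 ^ w

/-- All values that occur in the evaluation of an expression have at most `w` bits. -/
def Exp.Fits (w : ℕ) (s : State) : Exp → Prop
  | .const z => FitsWord w z
  | .reg r => FitsWord w (s.reg r)
  | .load a => a.Fits w s ∧ FitsWord w (s.mem (a.eval s).toNat)
  | .op o a b => a.Fits w s ∧ b.Fits w s ∧ FitsWord w (o.apply (a.eval s) (b.eval s))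

/-- The length and all entries of a list have at most `w` bits. -/
def FitsBlock (w : ℕ) (v : List ℤ) : Prop := FitsWord w v.length ∧ ∀ z ∈ v, FitsWord w z

/-- `Exec w c s t`: started in state `s`, the program `c` terminates in state `t`, and all integers
that occur have at most `w` bits.

A subroutine call `call c src dst` runs `c` on registers and a memory of its own, with the block
stored at address `src` as its input; the result of `c` is then stored as a block at address `dst`.
It takes the time of the subroutine, plus the time to evaluate the addresses and to transfer the
argument and the result word by word. -/
inductive Exec (w : ℕ) : Program → State → State → Prop
  | skip (s : State) : Exec w .skip s s
  | assign (s : State) (r : ℕ) (e : Exp) (he : e.Fits w s) :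
      Exec w (.assign r e) s ((s.setReg r (e.eval s)).tick (e.cost + 1))
  | store (s : State) (a e : Exp) (ha : a.Fits w s) (he : e.Fits w s) :
      Exec w (.store a e) s ((s.setMem (a.addr s) (e.eval s)).tick (a.cost + e.cost + 1))
  | output (s : State) (es : List Exp) (he : ∀ e ∈ es, e.Fits w s) :
      Exec w (.output es) s
        { s with
          clock := s.clock + ((es.map Exp.cost).sum + 1)
          out := s.out ++ [(es.map (Exp.eval s), s.clock + ((es.map Exp.cost).sum + 1))] }
  | seq (s t u : State) (c d : Program) (hc : Exec w c s t) (hd : Exec w d t u) :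
      Exec w (.seq c d) s u
  | ite_pos (s t : State) (e : Exp) (c d : Program) (he : e.Fits w s) (hpos : 0 < e.eval s)
      (hc : Exec w c (s.tick (e.cost + 1)) t) : Exec w (.ite e c d) s t
  | ite_neg (s t : State) (e : Exp) (c d : Program) (he : e.Fits w s) (hneg : ¬ 0 < e.eval s)
      (hd : Exec w d (s.tick (e.cost + 1)) t) : Exec w (.ite e c d) s t
  | loop_stop (s : State) (e : Exp) (c : Program) (he : e.Fits w s) (hneg : ¬ 0 < e.eval s) :
      Exec w (.loop e c) s (s.tick (e.cost + 1))
  | loop_step (s t u : State) (e : Exp) (c : Program) (he : e.Fits w s) (hpos : 0 < e.eval s)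
      (hc : Exec w c (s.tick (e.cost + 1)) t) (hrest : Exec w (.loop e c) t u) :
      Exec w (.loop e c) s u
  | call (s t : State) (c : Program) (src dst : Exp) (hsrc : src.Fits w s) (hdst : dst.Fits w s)
      (harg : FitsBlock w (readBlock s.mem (src.addr s)))
      (hc : Exec w c (State.start (readBlock s.mem (src.addr s))) t)
      (hres : FitsBlock w t.result) :
      Exec w (.call c src dst) s
        { s with
          mem := writeBlock s.mem (dst.addr s) t.result
          clock := s.clock + (src.cost + dst.cost + 1
            + (readBlock s.mem (src.addr s)).length + t.clock + t.result.length) }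

/-- On the input `v`, the program `c` terminates in state `t`, using only integers with at most
`w` bits. -/
def RunsTo (w : ℕ) (c : Program) (v : List ℤ) (t : State) : Prop :=
  FitsBlock w v ∧ Exec w c (State.start v) t

end RAM

/-! ### Biobjective combinatorial optimization -/

/-- An instance `(S, C)` of a biobjective combinatorial optimization problem, with
`S ⊆ {0,1}ⁿ` and `C ∈ ℚ^{2 × n}`. -/
structure BOCOInstance where
  n : ℕ
  S : Set (Fin n → Bool)
  C : Matrix (Fin 2) (Fin n) ℚ

namespace BOCOInstance

/-- A 0-1 vector as a vector over `R`. -/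
def toVec (R : Type*) [Zero R] [One R] {n : ℕ} (x : Fin n → Bool) : Fin n → R :=
  fun i => if x i then 1 else 0

/-- The input size `n + ⟨C⟩` of an instance. -/
def size (I : BOCOInstance) : ℕ := I.n + encMat I.C

/-- The set `{C x | x ∈ S}` of points. -/
def points (I : BOCOInstance) : Set (Fin 2 → ℚ) := (fun x => I.C.mulVec (toVec ℚ x)) '' I.S

/-- The upper image `{C x | x ∈ conv S} + ℝ²_≥` of the convex relaxation. -/
def upperImage (I : BOCOInstance) : Set (Fin 2 → ℝ) :=
  {y | ∃ x ∈ convexHull ℝ (toVec ℝ '' I.S), ∃ z : Fin 2 → ℝ, 0 ≤ z ∧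
    y = (I.C.map (Rat.cast : ℚ → ℝ)).mulVec x + z}

/-- The nondominated extreme points: the extreme points of the upper image of the convex
relaxation. -/
def nondominatedExtremePoints (I : BOCOInstance) : Set (Fin 2 → ℝ) :=
  I.upperImage.extremePoints ℝ

/-- `y` is optimal for the lexicographic weighted-sum problem
`lexmin {(ℓᵀ C x, c₁ x, c₂ x) | x ∈ S}`. -/
def IsLexOptimal (I : BOCOInstance) (ℓ y : Fin 2 → ℚ) : Prop :=
  y ∈ I.points ∧ ∀ y' ∈ I.points,
    toLex ![ℓ ⬝ᵥ y, y 0, y 1] ≤ toLex ![ℓ ⬝ᵥ y', y' 0, y' 1]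

end BOCOInstance

/-- A rational vector with two entries as a list of integers: numerators and (positive) denominators
in lowest terms. -/
def codePoint (y : Fin 2 → ℚ) : List ℤ := [(y 0).num, (y 0).den, (y 1).num, (y 1).den]

/-- A bit string as a list of integers. -/
def codeString (x : List Bool) : List ℤ := x.map fun b => if b then 1 else 0

/-- A biobjective combinatorial optimization problem: a set of bit strings, each of which encodes an
instance `(S, C)`, where `S` may be given implicitly; the length of the encoding is at most linear
in the input size `n + ⟨C⟩`. -/
structure BOCOProblem where
  lang : Set (List Bool)
  inst : List Bool → BOCOInstance
  length_le : ∃ K : ℕ, ∀ x ∈ lang, x.length ≤ K * ((inst x).size + 1)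

namespace BOCOProblem

/-- The program `A` solves the lexicographic version of the problem in polynomial time: given an
instance and a weight vector `ℓ ≥ 0`, it computes the optimal point of the lexicographic
weighted-sum problem, or returns the empty list if the instance has no solution. Running time and
word length are polynomial in the size of the instance plus the encoding length of `ℓ`. -/
def SolvesLexInPolyTime (P : BOCOProblem) (A : RAM.Program) : Prop :=
  ∃ p : Polynomial ℕ, ∀ x ∈ P.lang, ∀ ℓ : Fin 2 → ℚ, 0 ≤ ℓ →
    ∃ t : RAM.State,
      RAM.RunsTo (p.eval ((P.inst x).size + encVec ℓ)) A (codeString x ++ codePoint ℓ) t ∧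
      t.clock ≤ p.eval ((P.inst x).size + encVec ℓ) ∧
      (((P.inst x).S = ∅ ∧ t.result = []) ∨
        ∃ y, (P.inst x).IsLexOptimal ℓ y ∧ t.result = codePoint y)

/-- The program `c` enumerates the nondominated extreme points of the problem with polynomial delay:
on every instance it terminates, it outputs every nondominated extreme point exactly once and
nothing else, and the time before the first output, between two consecutive outputs, and
between the last output and termination is bounded by a polynomial in the input size, as is the
word length. -/
def EnumeratesExtremePointsWithPolyDelay (P : BOCOProblem) (c : RAM.Program) : Prop :=
  ∃ p : Polynomial ℕ, ∀ x ∈ P.lang,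
    ∃ t : RAM.State,
      RAM.RunsTo (p.eval (P.inst x).size) c (codeString x) t ∧
      (∃ L : List (Fin 2 → ℚ), L.Nodup ∧
        (fun (y : Fin 2 → ℚ) (i : Fin 2) => (y i : ℝ)) '' {y | y ∈ L} =
          (P.inst x).nondominatedExtremePoints ∧
        t.out.map Prod.fst = L.map codePoint) ∧
      List.IsChain (fun a b => b ≤ a + p.eval (P.inst x).size)
        ([0] ++ t.out.map Prod.snd ++ [t.clock])

end BOCOProblem

/-! ### The variant of the Dichotomic Approach

A point `(a / b, c / d)` is kept in four consecutive registers `p, p + 1, p + 2, p + 3` holding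
`a, b, c, d`. Let `N` be the length of the input. The memory holds the argument block of the
subroutine (the input, followed by the weights) at addresses `0, …, N + 4`, its result block
at addresses `N + 5, …, N + 9`, and the queue of triples from address `N + 10` on, twelve cells for
each triple. -/

namespace Dichotomic

open RAM RAM.Exp RAM.Program

/-- Register for the length `N` of the input. -/
def rN : ℕ := 0
/-- Register for the address of the first triple in the queue. -/
def rHead : ℕ := 1
/-- Register for the address behind the last triple in the queue. -/
def rTail : ℕ := 2
/-- Registers for the two components of the weight vector. -/
def rW₁ : ℕ := 3
def rW₂ : ℕ := 4
/-- First registers of the points `y`, `y²`, `y³` and `ȳ`. -/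
def rY : ℕ := 10
def rY₂ : ℕ := 20
def rY₃ : ℕ := 30
def rZ : ℕ := 40

/-- Load the point stored at address `a` into the registers from `p` on. -/
def loadPoint (p : ℕ) (a : Exp) : Program :=
  block [assign p (load a), assign (p + 1) (load (a + 1)),
    assign (p + 2) (load (a + 2)), assign (p + 3) (load (a + 3))]

/-- Store the point in the registers from `p` on at address `a`. -/
def storePoint (a : Exp) (p : ℕ) : Program :=
  block [store a (reg p), store (a + 1) (reg (p + 1)),
    store (a + 2) (reg (p + 2)), store (a + 3) (reg (p + 3))]

/-- Copy the point in the registers from `q` on to the registers from `p` on. -/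
def copyPoint (p q : ℕ) : Program :=
  block [assign p (reg q), assign (p + 1) (reg (q + 1)),
    assign (p + 2) (reg (q + 2)), assign (p + 3) (reg (q + 3))]

/-- Output the point in the registers from `p` on. -/
def outputPoint (p : ℕ) : Program :=
  output [reg p, reg (p + 1), reg (p + 2), reg (p + 3)]

def square (e : Exp) : Exp := e * e

/-- An expression that is positive if the points `p` and `q` are different, and zero otherwise. -/
def different (p q : ℕ) : Exp :=
  square (reg p - reg q) + square (reg (p + 1) - reg (q + 1)) +
    square (reg (p + 2) - reg (q + 2)) + square (reg (p + 3) - reg (q + 3))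

/-- Replace the content of register `r` by its absolute value. -/
def absolute (r : ℕ) : Program := ite (0 - reg r) (assign r (0 - reg r)) skip

/-- An expression that is positive if the last call of the subroutine found a point. -/
def feasible : Exp := load (reg rN + 5)

/-- Solve the lexicographic weighted-sum problem with the (integer) weights in the registers
`rW₁, rW₂` by means of the subroutine `A`, and put the optimal point into `rZ`. -/
def solveLex (A : Program) : Program :=
  block [store (reg rN + 1) (reg rW₁), store (reg rN + 2) 1,
    store (reg rN + 3) (reg rW₂), store (reg rN + 4) 1,
    call A 0 (reg rN + 5),
    loadPoint rZ (reg rN + 6)]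

/-- Compute the weight vector `λ = (|p₂ - q₂|, |p₁ - q₁|)`, for which `λᵀ p = λᵀ q`, multiplied by
the denominators of all components of the points `p` and `q`. -/
def computeWeights (p q : ℕ) : Program :=
  block [assign rW₁ (reg (p + 2) * reg (q + 3) - reg (q + 2) * reg (p + 3)),
    absolute rW₁,
    assign rW₁ (reg rW₁ * (reg (p + 1) * reg (q + 1))),
    assign rW₂ (reg p * reg (q + 1) - reg q * reg (p + 1)),
    absolute rW₂,
    assign rW₂ (reg rW₂ * (reg (p + 3) * reg (q + 3)))]

/-- Look for a nondominated extreme point `ȳ` between the points `p` and `q`. If the point `ȳ` found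
equals `p` or `q`, there is none; otherwise the triple `(ȳ, p, q)` is put into the queue. -/
def examine (A : Program) (p q : ℕ) : Program :=
  block [computeWeights p q,
    solveLex A,
    ite (different rZ p * different rZ q)
      (block [storePoint (reg rTail) rZ, storePoint (reg rTail + 4) p,
        storePoint (reg rTail + 8) q, assign rTail (reg rTail + 12)])
      skip]

/-- One iteration: retrieve a triple `(y, y², y³)` from the queue, output `y`, and examine the pairs
`(y, y²)` and `(y, y³)`. -/
def iteration (A : Program) : Program :=
  block [loadPoint rY (reg rHead), loadPoint rY₂ (reg rHead + 4), loadPoint rY₃ (reg rHead + 8),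
    assign rHead (reg rHead + 12),
    outputPoint rY,
    examine A rY rY₂,
    examine A rY rY₃]

/-- The variant of the Dichotomic Approach that uses the program `A` to solve the lexicographic
weighted-sum problems. -/
def variant (A : Program) : Program :=
  block [
    -- set up the argument block and the empty queue
    assign rN (load 0), store 0 (reg rN + 4),
    assign rHead (reg rN + 10), assign rTail (reg rN + 10),
    -- solve the problem for the weights `(1, 0)`
    assign rW₁ 1, assign rW₂ 0, solveLex A,
    ite feasible
      (block [
        copyPoint rY₂ rZ,
        -- solve the problem for the weights `(0, 1)`
        assign rW₁ 0, assign rW₂ 1, solveLex A,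
        copyPoint rY₃ rZ,
        outputPoint rY₂,
        ite (different rY₂ rY₃)
          (block [
            outputPoint rY₃,
            examine A rY₂ rY₃,
            loop (reg rTail - reg rHead) (iteration A)])
          skip])
      skip]

end Dichotomic

/-! ### Geometry of the upper image -/

/-! Every extreme point of the upper image is the image of a feasible solution (`image_extremes`),
so the proof works with the finite set `extremes` of rational points. Ordered by increasing first
coordinate, these points have strictly decreasing second coordinate. A pair of them therefore
delimits a gap, which `Between` expresses by first coordinates alone.

Two geometric facts drive the algorithm. A lexicographic optimum for nonnegative weights is an
extreme point (`IsLexOptimal.mem_extremes`): the upper image lies in a convex "lexicographic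
half-space" of which the optimum is an extreme point. The tie-breaking is essential, since a plain
weighted-sum optimum may lie inside an edge. Secondly, take weights normal to the line through two
extreme points `p`, `q` (`IsLexOptimal.examine`). An extreme point in the gap would lie strictly
below this line, so an optimum equal to `p` or `q` certifies an empty gap; any other optimum lies
inside the gap.

Correctness is a conservation law (`Inv.count`): for every extreme point, the number of times it has
been output plus the number of queued or pending gaps containing it is always 1. Outputting a point
`y` of the gap `(p, q)` replaces that gap by `y` and the gaps `(y, p)`, `(y, q)` (`between_split`).
Hence nothing is output twice, and nothing is missing once the queue is empty. The loop ends because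
each iteration lengthens a duplicate-free list of at most `2 ^ n` points.

The delay is polynomial because each iteration outputs a point and then makes only two calls of `A`.
Their weights are short, since heights of rationals are submultiplicative under addition and so
points have numerators and denominators of linear bit length. The queue may become exponentially
long, but its addresses still have polynomially many bits. -/

theorem toLex_vec3_le_iff (a b c a' b' c' : ℚ) :
    toLex ![a, b, c] ≤ toLex ![a', b', c'] ↔
      a < a' ∨ a = a' ∧ (b < b' ∨ b = b' ∧ c ≤ c') := by
  rw [le_iff_lt_or_eq, toLex_inj]
  change (∃ i, (∀ j, j < i → ![a, b, c] j = ![a', b', c'] j) ∧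
    ![a, b, c] i < ![a', b', c'] i) ∨ _ ↔ _
  simp only [Fin.exists_fin_succ, Fin.forall_fin_succ, Matrix.vecCons_inj]
  simp
  grind

namespace BOCOInstance

/-- A rational point as a real point. -/
def realPoint (y : Fin 2 → ℚ) : Fin 2 → ℝ := fun i => (y i : ℝ)

theorem realPoint_injective : Function.Injective realPoint := fun y z h =>
  funext fun i => by simpa [realPoint] using congrFun h i

theorem realPoint_mulVec {n : ℕ} (C : Matrix (Fin 2) (Fin n) ℚ) (x : Fin n → Bool) :
    realPoint (C.mulVec (toVec ℚ x)) = (C.map (Rat.cast : ℚ → ℝ)).mulVec (toVec ℝ x) := by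
  ext i
  simp only [realPoint, Matrix.mulVec, dotProduct, toVec, Rat.cast_sum, Matrix.map_apply]
  refine Finset.sum_congr rfl fun j _ => ?_
  split_ifs <;> simp

variable {I : BOCOInstance}

/-- Linear maps commute with convex hulls. This moves the geometry from the solution space to the
plane. -/
theorem mem_upperImage_iff {y : Fin 2 → ℝ} :
    y ∈ I.upperImage ↔
      ∃ c ∈ convexHull ℝ (realPoint '' I.points), c ≤ y := by
  have himage : (I.C.map (Rat.cast : ℚ → ℝ)).mulVecLin '' convexHull ℝ (toVec ℝ '' I.S) =
      convexHull ℝ (realPoint '' I.points) := by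
    rw [LinearMap.image_convexHull, points, Set.image_image, Set.image_image]
    simp [realPoint_mulVec]
  rw [← himage]
  constructor
  · rintro ⟨x, hx, z, hz, rfl⟩
    exact ⟨_, ⟨x, hx, rfl⟩, by simpa using hz⟩
  · rintro ⟨_, ⟨x, hx, rfl⟩, hle⟩
    exact ⟨x, hx, y - (I.C.map (Rat.cast : ℚ → ℝ)).mulVecLin x, sub_nonneg.2 hle, by simp⟩

theorem mem_upperImage_of_le {u v : Fin 2 → ℝ} (hu : u ∈ I.upperImage) (huv : u ≤ v) :
    v ∈ I.upperImage := by
  rw [mem_upperImage_iff] at hu ⊢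
  obtain ⟨c, hc, hcu⟩ := hu
  exact ⟨c, hc, hcu.trans huv⟩

theorem realPoint_mem_upperImage {y : Fin 2 → ℚ} (hy : y ∈ I.points) :
    realPoint y ∈ I.upperImage :=
  mem_upperImage_iff.2 ⟨_, subset_convexHull ℝ _ ⟨y, hy, rfl⟩, le_rfl⟩

theorem convex_upperImage : Convex ℝ I.upperImage := by
  intro u hu v hv a b ha hb hab
  rw [mem_upperImage_iff] at *
  obtain ⟨c, hc, hcu⟩ := hu
  obtain ⟨d, hd, hdv⟩ := hv
  exact ⟨_, convex_convexHull ℝ _ hc hd ha hb hab,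
    add_le_add (smul_le_smul_of_nonneg_left hcu ha) (smul_le_smul_of_nonneg_left hdv hb)⟩

/-- The point `q` is the midpoint of `p` and `q + (q - p)`, and the latter is in the upper image
because it dominates `q`. -/
theorem eq_of_le_of_mem_extremePoints {p q : Fin 2 → ℝ} (hp : p ∈ I.upperImage)
    (hq : q ∈ I.upperImage.extremePoints ℝ) (hpq : p ≤ q) : p = q := by
  have hr : q + (q - p) ∈ I.upperImage :=
    mem_upperImage_of_le hq.1 (le_add_of_nonneg_right (sub_nonneg.2 hpq))
  refine hq.2 hp hr ⟨1 / 2, 1 / 2, by norm_num, by norm_num, by norm_num, ?_⟩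
  ext i
  simp only [Pi.add_apply, Pi.smul_apply, Pi.sub_apply, smul_eq_mul]
  ring

/-- An extreme point of the upper image lies strictly below the line through two points on
either side of it. -/
theorem lt_of_mem_extremePoints {a b c : Fin 2 → ℝ} (ha : a ∈ I.upperImage)
    (hb : b ∈ I.upperImage.extremePoints ℝ) (hc : c ∈ I.upperImage) (hab : a 0 < b 0)
    (hbc : b 0 < c 0) : (b 1 - a 1) * (c 0 - a 0) < (c 1 - a 1) * (b 0 - a 0) := by
  by_contra! hle
  have hac : 0 < c 0 - a 0 := by linarith
  -- With this `t`, `(1 - t) • a + t • c` is the point of the chord with the same first coordinate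
  -- as `b`. If `b` is not strictly below the chord, this point is at most `b`, hence equals `b`,
  -- which puts `b` in the open segment from `a` to `c`.
  set t := (b 0 - a 0) / (c 0 - a 0) with ht
  have ht0 : 0 < t := div_pos (by linarith) hac
  have ht1 : t < 1 := (div_lt_one hac).2 (by linarith)
  have htm : t * (c 0 - a 0) = b 0 - a 0 := div_mul_cancel₀ _ hac.ne'
  have hle' : (1 - t) • a + t • c ≤ b := by
    intro i
    fin_cases i
    · simp; linarith
    · have : t * (c 1 - a 1) ≤ b 1 - a 1 := by
        rw [ht, div_mul_eq_mul_div, div_le_iff₀ hac]; linarith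
      simp; linarith
  have hmem : (1 - t) • a + t • c ∈ I.upperImage :=
    convex_upperImage ha hc (by linarith) ht0.le (by ring)
  have heq := eq_of_le_of_mem_extremePoints hmem hb hle'
  have := hb.2 ha hc ⟨1 - t, t, by linarith, ht0, by ring, heq⟩
  rw [this] at hab
  exact lt_irrefl _ hab

/-- The rational points that are nondominated extreme points. -/
def extremes (I : BOCOInstance) : Set (Fin 2 → ℚ) :=
  {y | y ∈ I.points ∧ realPoint y ∈ I.upperImage.extremePoints ℝ}

/-- An extreme point dominates a point of the convex hull and therefore equals it. It is then also
extreme in the smaller set, the hull, whose extreme points belong to the generating set. -/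
theorem image_extremes : realPoint '' I.extremes = I.nondominatedExtremePoints := by
  apply Set.Subset.antisymm
  · rintro _ ⟨y, hy, rfl⟩
    exact hy.2
  · intro z hz
    obtain ⟨c, hc, hcz⟩ := mem_upperImage_iff.1 hz.1
    obtain rfl := eq_of_le_of_mem_extremePoints (mem_upperImage_iff.2 ⟨c, hc, le_rfl⟩) hz hcz
    have hsub : convexHull ℝ (realPoint '' I.points) ⊆ I.upperImage := fun u hu =>
      mem_upperImage_iff.2 ⟨u, hu, le_rfl⟩
    have hmem : c ∈ (convexHull ℝ (realPoint '' I.points)).extremePoints ℝ :=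
      inter_extremePoints_subset_extremePoints_of_subset hsub ⟨hc, hz⟩
    obtain ⟨y, hy, rfl⟩ := extremePoints_convexHull_subset hmem
    exact ⟨y, ⟨hy, hz⟩, rfl⟩

theorem eq_of_le_of_mem_extremes {p q : Fin 2 → ℚ} (hp : p ∈ I.points) (hq : q ∈ I.extremes)
    (h0 : p 0 ≤ q 0) (h1 : p 1 ≤ q 1) : p = q := by
  refine realPoint_injective
    (eq_of_le_of_mem_extremePoints (realPoint_mem_upperImage hp) hq.2 fun i => ?_)
  fin_cases i
  · simpa [realPoint] using h0
  · simpa [realPoint] using h1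

theorem lt_of_mem_extremes {a b c : Fin 2 → ℚ} (ha : a ∈ I.points) (hb : b ∈ I.extremes)
    (hc : c ∈ I.points) (hab : a 0 < b 0) (hbc : b 0 < c 0) :
    (b 1 - a 1) * (c 0 - a 0) < (c 1 - a 1) * (b 0 - a 0) := by
  have := lt_of_mem_extremePoints (realPoint_mem_upperImage ha) hb.2 (realPoint_mem_upperImage hc)
    (by simpa [realPoint] using hab) (by simpa [realPoint] using hbc)
  simp only [realPoint] at this
  exact_mod_cast this

theorem eq_of_fst_eq {p q : Fin 2 → ℚ} (hp : p ∈ I.extremes) (hq : q ∈ I.extremes)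
    (h : p 0 = q 0) : p = q := by
  rcases le_total (p 1) (q 1) with h1 | h1
  · exact eq_of_le_of_mem_extremes hp.1 hq h.le h1
  · exact (eq_of_le_of_mem_extremes hq.1 hp h.ge h1).symm

theorem snd_lt_of_fst_lt {p q : Fin 2 → ℚ} (hp : p ∈ I.extremes) (hq : q ∈ I.extremes)
    (h : p 0 < q 0) : q 1 < p 1 := by
  by_contra! h1
  rw [eq_of_le_of_mem_extremes hp.1 hq h.le h1] at h
  exact lt_irrefl _ h

/-! ### Lexicographic optima are extreme points -/

theorem isLexOptimal_iff {ℓ y : Fin 2 → ℚ} :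
    I.IsLexOptimal ℓ y ↔ y ∈ I.points ∧ ∀ z ∈ I.points,
      ℓ 0 * y 0 + ℓ 1 * y 1 < ℓ 0 * z 0 + ℓ 1 * z 1 ∨
      ℓ 0 * y 0 + ℓ 1 * y 1 = ℓ 0 * z 0 + ℓ 1 * z 1 ∧
        (y 0 < z 0 ∨ y 0 = z 0 ∧ y 1 ≤ z 1) := by
  simp only [IsLexOptimal, toLex_vec3_le_iff, dotProduct, Fin.sum_univ_two]

theorem IsLexOptimal.le {ℓ y z : Fin 2 → ℚ} (hy : I.IsLexOptimal ℓ y) (hz : z ∈ I.points) :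
    ℓ 0 * y 0 + ℓ 1 * y 1 ≤ ℓ 0 * z 0 + ℓ 1 * z 1 := by
  rcases (isLexOptimal_iff.1 hy).2 z hz with h | h
  · exact h.le
  · exact h.1.le

/-- The points that are not smaller than `y` in the lexicographic order given by the weights
`(k, l)` and the two coordinates. -/
def lexHalfSpace (k l : ℝ) (y : Fin 2 → ℝ) : Set (Fin 2 → ℝ) :=
  {z | k * y 0 + l * y 1 < k * z 0 + l * z 1 ∨
      k * y 0 + l * y 1 = k * z 0 + l * z 1 ∧ (y 0 < z 0 ∨ y 0 = z 0 ∧ y 1 ≤ z 1)}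

theorem lt_convexComb {a b c u v : ℝ} (ha : 0 < a) (hb : 0 < b) (hab : a + b = 1)
    (hu : c < u) (hv : c ≤ v) : c < a * u + b * v := by
  calc c = a * c + b * c := by rw [← add_mul, hab, one_mul]
    _ < a * u + b * v :=
      add_lt_add_of_lt_of_le (mul_lt_mul_of_pos_left hu ha) (mul_le_mul_of_nonneg_left hv hb.le)

/-- At each of the three levels, a strict inequality at one endpoint together with a weak one at the
other is strict for the combination. If both endpoints attain equality, so does the combination, and
the next level decides. -/
theorem convex_lexHalfSpace (k l : ℝ) (y : Fin 2 → ℝ) : Convex ℝ (lexHalfSpace k l y) := by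
  rw [convex_iff_forall_pos]
  intro u hu v hv a b ha hb hab
  have hc : ∀ c : ℝ, c = a * c + b * c := fun c => by rw [← add_mul, hab, one_mul]
  have hk : k * (a * u 0 + b * v 0) + l * (a * u 1 + b * v 1) =
      a * (k * u 0 + l * u 1) + b * (k * v 0 + l * v 1) := by ring
  simp only [lexHalfSpace, Set.mem_ofPred_eq, Pi.add_apply, Pi.smul_apply, smul_eq_mul, hk] at *
  rcases hu with hu | ⟨hu, hu'⟩
  · exact .inl (lt_convexComb ha hb hab hu (by rcases hv with hv | hv; exacts [hv.le, hv.1.le]))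
  rcases hv with hv | ⟨hv, hv'⟩
  · refine .inl ?_
    rw [add_comm (a * _)]
    exact lt_convexComb hb ha (by linarith) hv hu.le
  refine .inr ⟨by rw [← hu, ← hv]; exact hc _, ?_⟩
  rcases hu' with hu' | ⟨hu', hu''⟩
  · exact .inl (lt_convexComb ha hb hab hu' (by rcases hv' with hv | hv; exacts [hv.le, hv.1.le]))
  rcases hv' with hv' | ⟨hv', hv''⟩
  · refine .inl ?_
    rw [add_comm (a * _)]
    exact lt_convexComb hb ha (by linarith) hv' hu'.le
  · refine .inr ⟨by rw [← hu', ← hv']; exact hc _, ?_⟩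
    rw [hc (y 1)]
    exact add_le_add (mul_le_mul_of_nonneg_left hu'' ha.le) (mul_le_mul_of_nonneg_left hv'' hb.le)

theorem mem_lexHalfSpace_of_le {k l : ℝ} (hk : 0 ≤ k) (hl : 0 ≤ l) {y u v : Fin 2 → ℝ}
    (hu : u ∈ lexHalfSpace k l y) (huv : u ≤ v) : v ∈ lexHalfSpace k l y := by
  have h0 := huv 0
  have h1 := huv 1
  have hw : k * u 0 + l * u 1 ≤ k * v 0 + l * v 1 :=
    add_le_add (mul_le_mul_of_nonneg_left h0 hk) (mul_le_mul_of_nonneg_left h1 hl)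
  simp only [lexHalfSpace, Set.mem_ofPred_eq] at *
  grind

/-- Thus `y` is an extreme point of its lexicographic half-space. Level by level, the value at `y`
is a proper convex combination of two values that are at least as large, so both equal it. This
equality turns the next level of the order into an inequality for both endpoints. -/
theorem eq_of_mem_lexHalfSpace {k l : ℝ} {y u v : Fin 2 → ℝ} (hu : u ∈ lexHalfSpace k l y)
    (hv : v ∈ lexHalfSpace k l y) (hy : y ∈ openSegment ℝ u v) : u = y := by
  obtain ⟨a, b, ha, hb, hab, rfl⟩ := hy
  have hc : ∀ c : ℝ, a * c + b * c = c := fun c => by rw [← add_mul, hab, one_mul]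
  set y := a • u + b • v with hy
  have h0 : y 0 = a * u 0 + b * v 0 := by simp [hy]
  have h1 : y 1 = a * u 1 + b * v 1 := by simp [hy]
  have hw : k * y 0 + l * y 1 = a * (k * u 0 + l * u 1) + b * (k * v 0 + l * v 1) := by
    rw [h0, h1]; ring
  have key : ∀ {c s t : ℝ}, c = a * s + b * t → c ≤ s → c ≤ t → s = c ∧ t = c := by
    intro c s t h hs ht
    constructor
    · by_contra hne
      exact (lt_convexComb ha hb hab (lt_of_le_of_ne hs (Ne.symm hne)) ht).ne h
    · by_contra hne
      exact (lt_convexComb hb ha (by linarith) (lt_of_le_of_ne ht (Ne.symm hne)) hs).ne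
        (by linarith)
  simp only [lexHalfSpace, Set.mem_ofPred_eq] at hu hv
  obtain ⟨hu1, hv1⟩ := key hw (by grind) (by grind)
  have hu' := (hu.resolve_left (by rw [hu1]; exact lt_irrefl _)).2
  have hv' := (hv.resolve_left (by rw [hv1]; exact lt_irrefl _)).2
  obtain ⟨hu2, hv2⟩ := key h0 (by grind) (by grind)
  obtain ⟨hu3, -⟩ := key h1 (by grind) (by grind)
  ext i
  fin_cases i
  · exact hu2
  · exact hu3

theorem IsLexOptimal.mem_extremes {ℓ y : Fin 2 → ℚ} (hℓ : 0 ≤ ℓ) (hy : I.IsLexOptimal ℓ y) :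
    y ∈ I.extremes := by
  rw [isLexOptimal_iff] at hy
  have hsub : I.upperImage ⊆ lexHalfSpace (ℓ 0) (ℓ 1) (realPoint y) := by
    intro z hz
    obtain ⟨c, hc, hcz⟩ := mem_upperImage_iff.1 hz
    refine mem_lexHalfSpace_of_le (by exact_mod_cast hℓ 0) (by exact_mod_cast hℓ 1) ?_ hcz
    refine convexHull_min ?_ (convex_lexHalfSpace _ _ _) hc
    rintro _ ⟨u, hu, rfl⟩
    have := hy.2 u hu
    simp only [lexHalfSpace, Set.mem_ofPred_eq, realPoint]
    exact_mod_cast this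
  exact ⟨hy.1, realPoint_mem_upperImage hy.1, fun u hu v hv h =>
    eq_of_mem_lexHalfSpace (hsub hu) (hsub hv) h⟩

/-- The first coordinate of `z` lies strictly between those of `p` and `q`. -/
def Between (p q z : Fin 2 → ℚ) : Prop := p 0 < z 0 ∧ z 0 < q 0 ∨ q 0 < z 0 ∧ z 0 < p 0

theorem between_comm {p q z : Fin 2 → ℚ} : Between p q z ↔ Between q p z := Or.comm

/-- Everything follows from `lt_of_mem_extremes`. If `y` is `p` or `q`, an extreme point in the gap
would lie below the chord and beat `y`. If `y` lay beyond `p`, then `p` would be strictly below the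
line through `y` and `q` and would beat `y`; the other side is symmetric. -/
theorem IsLexOptimal.eq_or_eq_or_between {p q y ℓ : Fin 2 → ℚ} (hp : p ∈ I.extremes)
    (hq : q ∈ I.extremes) (hpq : p 0 < q 0) {d : ℚ} (hd : 0 < d)
    (h0 : ℓ 0 = (p 1 - q 1) * d) (h1 : ℓ 1 = (q 0 - p 0) * d) (hy : I.IsLexOptimal ℓ y) :
    y ∈ I.extremes ∧ (y = p ∨ y = q → ∀ z ∈ I.extremes, ¬ Between p q z) ∧
      (y ≠ p → y ≠ q → Between p q y) := by
  have hsnd := snd_lt_of_fst_lt hp hq hpq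
  have hle : ∀ z ∈ I.points,
      (p 1 - q 1) * y 0 + (q 0 - p 0) * y 1 ≤ (p 1 - q 1) * z 0 + (q 0 - p 0) * z 1 := by
    intro z hz
    have := hy.le hz
    rw [h0, h1] at this
    refine le_of_mul_le_mul_right ?_ hd
    linarith
  have hyE : y ∈ I.extremes := by
    refine hy.mem_extremes fun i => ?_
    fin_cases i
    · simp only [Pi.zero_apply, Fin.zero_eta, h0]
      exact mul_nonneg (by linarith) hd.le
    · simp only [Pi.zero_apply, Fin.mk_one, h1]
      exact mul_nonneg (by linarith) hd.le
  refine ⟨hyE, ?_, ?_⟩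
  · rintro hypq z hz (⟨hpz, hzq⟩ | ⟨hqz, hzp⟩)
    · have hlt := lt_of_mem_extremes hp.1 hz hq.1 hpz hzq
      have := hle z hz.1
      rcases hypq with rfl | rfl <;> linarith
    · linarith
  · intro hyp hyq
    refine .inl ⟨?_, ?_⟩
    · rcases lt_trichotomy (y 0) (p 0) with h | h | h
      · have hlt := lt_of_mem_extremes hy.1 hp hq.1 h hpq
        have := hle p hp.1
        linarith
      · exact absurd (eq_of_fst_eq hyE hp h) hyp
      · exact h
    · rcases lt_trichotomy (y 0) (q 0) with h | h | h
      · exact h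
      · exact absurd (eq_of_fst_eq hyE hq h) hyq
      · have hlt := lt_of_mem_extremes hp.1 hq hy.1 hpq h
        have := hle q hq.1
        linarith

/-- Examination of a pair of nondominated extreme points: the lexicographically optimal point for
the weights `(|p₂ - q₂|, |p₁ - q₁|)` is a new nondominated extreme point between the two, unless
there is none. -/
theorem IsLexOptimal.examine {p q y ℓ : Fin 2 → ℚ} (hp : p ∈ I.extremes)
    (hq : q ∈ I.extremes) (hpq : p ≠ q) {d : ℚ} (hd : 0 < d)
    (h0 : ℓ 0 = |p 1 - q 1| * d) (h1 : ℓ 1 = |p 0 - q 0| * d) (hy : I.IsLexOptimal ℓ y) :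
    y ∈ I.extremes ∧ (y = p ∨ y = q → ∀ z ∈ I.extremes, ¬ Between p q z) ∧
      (y ≠ p → y ≠ q → Between p q y) := by
  rcases lt_trichotomy (p 0) (q 0) with h | h | h
  · have hsnd := snd_lt_of_fst_lt hp hq h
    rw [abs_of_pos (sub_pos.2 hsnd)] at h0
    rw [abs_sub_comm, abs_of_pos (sub_pos.2 h)] at h1
    exact hy.eq_or_eq_or_between hp hq h hd h0 h1
  · exact absurd (eq_of_fst_eq hp hq h) hpq
  · have hsnd := snd_lt_of_fst_lt hq hp h
    rw [abs_sub_comm, abs_of_pos (sub_pos.2 hsnd)] at h0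
    rw [abs_of_pos (sub_pos.2 h)] at h1
    obtain ⟨h1, h2, h3⟩ := hy.eq_or_eq_or_between hq hp h hd h0 h1
    exact ⟨h1, fun hpq z hz hb => h2 hpq.symm z hz (between_comm.1 hb),
      fun hp hq => between_comm.1 (h3 hq hp)⟩

/-- The two initial points enclose all the others: an extreme point `z` not strictly between them in
first coordinate would be dominated by `y₀` or by `y₁`, hence equal to it. This starts the count of
the invariant. -/
theorem extremes_eq_or_between {y₀ y₁ z : Fin 2 → ℚ} (h₀ : I.IsLexOptimal ![1, 0] y₀)
    (h₁ : I.IsLexOptimal ![0, 1] y₁) (hz : z ∈ I.extremes) :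
    z = y₀ ∨ z = y₁ ∨ y₀ 0 < z 0 ∧ z 0 < y₁ 0 := by
  rw [or_iff_not_imp_left]
  intro hz₀
  rw [or_iff_not_imp_left]
  intro hz₁
  have h0 := (isLexOptimal_iff.1 h₀).2 z hz.1
  have h1 := h₁.le hz.1
  simp only [Matrix.cons_val_zero, Matrix.cons_val_one, one_mul, zero_mul, add_zero,
    zero_add] at h0 h1
  constructor
  · by_contra! hle
    exact hz₀ (eq_of_le_of_mem_extremes h₀.1 hz (by grind) (by grind)).symm
  · by_contra! hle
    exact hz₁ (eq_of_le_of_mem_extremes h₁.1 hz hle h1).symm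

/-! ### Bounds on the number of extreme points -/

theorem finite_points : I.points.Finite := (Set.toFinite I.S).image _

theorem ncard_points_le : I.points.ncard ≤ 2 ^ I.n := by
  refine (Set.ncard_image_le (Set.toFinite I.S)).trans ?_
  refine (Set.ncard_le_ncard (Set.subset_univ _)).trans ?_
  simp [Set.ncard_univ]

theorem length_le_of_nodup {L : List (Fin 2 → ℚ)} (hL : L.Nodup) (hsub : ∀ y ∈ L, y ∈ I.extremes) :
    L.length ≤ 2 ^ I.n := by
  classical
  refine le_trans ?_ (ncard_points_le (I := I))
  rw [← List.toFinset_card_of_nodup hL, ← Set.ncard_coe_finset]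
  refine Set.ncard_le_ncard (fun y hy => (hsub y ?_).1) finite_points
  simpa using hy

end BOCOInstance

/-! ### Encoding lengths of points and weights -/

open RAM

/-- The sum of numerator (in absolute value) and denominator of a rational number. -/
def ratHeight (q : ℚ) : ℕ := q.num.natAbs + q.den

theorem ratHeight_zero : ratHeight 0 = 1 := rfl

/-- Expanding the product gives the size of the unreduced sum fraction plus the extra term `|a.num|
* |b.num|`, and reduction makes numerator and denominator no larger. Submultiplicativity makes the
bit length of a long sum additive in those of its terms. -/
theorem ratHeight_add_le (a b : ℚ) : ratHeight (a + b) ≤ ratHeight a * ratHeight b := by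
  have hnum : (a + b).num.natAbs ≤ a.num.natAbs * b.den + a.den * b.num.natAbs := by
    rcases eq_or_ne (a.num * b.den + a.den * b.num) 0 with h | h
    · rw [Rat.add_def', Rat.mkRat_eq_divInt, mul_comm b.num, h]
      simp
    · have hdvd : (a + b).num ∣ a.num * b.den + a.den * b.num := by
        rw [Rat.add_def', Rat.mkRat_eq_divInt, mul_comm b.num]
        exact Rat.num_dvd _ (by exact_mod_cast (mul_pos a.den_pos b.den_pos).ne')
      refine (Nat.le_of_dvd (Int.natAbs_pos.2 h) (Int.natAbs_dvd_natAbs.2 hdvd)).trans ?_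
      refine (Int.natAbs_add_le _ _).trans ?_
      simp [Int.natAbs_mul]
  have hden : (a + b).den ≤ a.den * b.den :=
    Nat.le_of_dvd (mul_pos a.den_pos b.den_pos) (Rat.add_den_dvd a b)
  unfold ratHeight
  nlinarith [Nat.zero_le (a.num.natAbs * b.num.natAbs)]

theorem ratHeight_sum_le {ι : Type*} (s : Finset ι) (f : ι → ℚ) :
    ratHeight (∑ i ∈ s, f i) ≤ ∏ i ∈ s, ratHeight (f i) := by
  classical
  induction s using Finset.induction_on with
  | empty => simp [ratHeight_zero]
  | insert i s hi ih =>
    rw [Finset.sum_insert hi, Finset.prod_insert hi]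
    exact (ratHeight_add_le _ _).trans (Nat.mul_le_mul_left _ ih)

theorem two_mul_natAbs_add_one_le_two_pow (z : ℤ) : 2 * (z.natAbs + 1) ≤ 2 ^ encInt z := by
  rw [encInt, pow_add, pow_one]
  exact Nat.mul_le_mul_left _ (Nat.le_pow_clog one_lt_two _)

theorem ratHeight_le_two_pow (q : ℚ) : ratHeight q ≤ 2 ^ encRat q := by
  have h1 := two_mul_natAbs_add_one_le_two_pow q.num
  have h2 := two_mul_natAbs_add_one_le_two_pow q.den
  rw [encRat, pow_add]
  refine le_trans ?_ (Nat.mul_le_mul h1 h2)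
  simp only [ratHeight, Int.natAbs_natCast]
  have : 0 ≤ q.num.natAbs * q.den := Nat.zero_le _
  ring_nf
  omega

namespace BOCOInstance

variable {I : BOCOInstance}

theorem ratHeight_le_of_mem_points {y : Fin 2 → ℚ} (hy : y ∈ I.points) (i : Fin 2) :
    ratHeight (y i) ≤ 2 ^ I.size := by
  obtain ⟨x, -, rfl⟩ := hy
  refine (ratHeight_sum_le _ _).trans ?_
  calc ∏ j, ratHeight (I.C i j * toVec ℚ x j) ≤ ∏ j, 2 ^ encRat (I.C i j) := by
        refine Finset.prod_le_prod' fun j _ => ?_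
        unfold toVec
        split_ifs
        · rw [mul_one]
          exact ratHeight_le_two_pow _
        -- Variables set to 0 contribute the factor 1, so the bound does not depend on the solution.
        · rw [mul_zero, ratHeight_zero]
          exact Nat.one_le_two_pow
    _ = 2 ^ ∑ j, encRat (I.C i j) := Finset.prod_pow_eq_pow_sum _ _ _
    _ ≤ 2 ^ I.size := by
        refine Nat.pow_le_pow_right two_pos ?_
        have h1 : encVec (I.C i) ≤ ∑ i, encVec (I.C i) :=
          Finset.single_le_sum (f := fun i => encVec (I.C i)) (fun _ _ => Nat.zero_le _)
            (Finset.mem_univ i)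
        simp only [size, encMat]
        simp only [encVec] at h1 ⊢
        omega

theorem fits_of_mem_points {y : Fin 2 → ℚ} (hy : y ∈ I.points) (i : Fin 2) :
    FitsWord (I.size + 1) (y i).num ∧ FitsWord (I.size + 1) ((y i).den : ℤ) := by
  have h := ratHeight_le_of_mem_points hy i
  have hden := (y i).den_pos
  unfold ratHeight at h
  simp only [FitsWord, Int.natAbs_natCast, pow_succ]
  omega

end BOCOInstance

theorem encInt_le {w : ℕ} {z : ℤ} (h : FitsWord w z) : encInt z ≤ w + 1 := by
  have : Nat.clog 2 (z.natAbs + 1) ≤ w := Nat.clog_le_of_le_pow h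
  unfold encInt
  omega

theorem encVec_intCast_le {w : ℕ} {a b : ℤ} (ha : FitsWord w a) (hb : FitsWord w b) :
    encVec ![(a : ℚ), (b : ℚ)] ≤ 2 * w + 8 := by
  have h1 : encInt 1 = 2 := by
    rw [encInt]
    norm_num [Nat.clog_of_two_le]
  have := encInt_le ha
  have := encInt_le hb
  simp [encVec, encRat, h1]
  omega

theorem codePoint_intCast (a b : ℤ) : codePoint ![(a : ℚ), (b : ℚ)] = [a, 1, b, 1] := by
  simp [codePoint]

theorem codePoint_injective : Function.Injective codePoint := by
  intro y z h
  simp only [codePoint, List.cons.injEq, Nat.cast_inj, and_true] at h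
  ext i
  fin_cases i
  · exact Rat.ext h.1 h.2.1
  · exact Rat.ext h.2.2.1 h.2.2.2

/-! ### Word lengths and their enlargement -/

namespace RAM

theorem FitsWord.mono {u v : ℕ} {z : ℤ} (h : FitsWord u z) (huv : u ≤ v) : FitsWord v z :=
  lt_of_lt_of_le h (Nat.pow_le_pow_right two_pos huv)

theorem FitsWord.mul {u v : ℕ} {a b : ℤ} (ha : FitsWord u a) (hb : FitsWord v b) :
    FitsWord (u + v) (a * b) := by
  unfold FitsWord at *
  rw [Int.natAbs_mul, pow_add]
  exact Nat.mul_lt_mul'' ha hb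

theorem FitsWord.add {u : ℕ} {a b : ℤ} (ha : FitsWord u a) (hb : FitsWord u b) :
    FitsWord (u + 1) (a + b) := by
  unfold FitsWord at *
  rw [pow_succ]
  omega

theorem FitsWord.sub {u : ℕ} {a b : ℤ} (ha : FitsWord u a) (hb : FitsWord u b) :
    FitsWord (u + 1) (a - b) := by
  unfold FitsWord at *
  rw [pow_succ]
  omega

theorem FitsWord.abs {u : ℕ} {a : ℤ} (ha : FitsWord u a) : FitsWord u |a| := by
  unfold FitsWord at *
  rwa [Int.natAbs_abs]

theorem FitsBlock.mono {u v : ℕ} {l : List ℤ} (h : FitsBlock u l) (huv : u ≤ v) :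
    FitsBlock v l :=
  ⟨h.1.mono huv, fun z hz => (h.2 z hz).mono huv⟩

theorem Exp.Fits.mono {u v : ℕ} (huv : u ≤ v) {s : State} {e : Exp} (h : e.Fits u s) :
    e.Fits v s := by
  induction e with
  | const z => exact FitsWord.mono h huv
  | reg r => exact FitsWord.mono h huv
  | load a ih => exact ⟨ih h.1, h.2.mono huv⟩
  | op o a b iha ihb => exact ⟨iha h.1, ihb h.2.1, h.2.2.mono huv⟩

/-- The word length granted to the subroutine depends on the weights; this transfers its runs to the
single larger word length of the whole algorithm. -/
theorem Exec.mono {u v : ℕ} (huv : u ≤ v) {c : Program} {s t : State} (h : Exec u c s t) :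
    Exec v c s t := by
  induction h with
  | skip s => exact .skip s
  | assign s r e he => exact .assign s r e (he.mono huv)
  | store s a e ha he => exact .store s a e (ha.mono huv) (he.mono huv)
  | output s es he => exact .output s es fun e h => (he e h).mono huv
  | seq s t u c d _ _ ihc ihd => exact .seq s t u c d ihc ihd
  | ite_pos s t e c d he hpos _ ih => exact .ite_pos s t e c d (he.mono huv) hpos ih
  | ite_neg s t e c d he hneg _ ih => exact .ite_neg s t e c d (he.mono huv) hneg ih
  | loop_step s t u e c he hpos _ _ ih1 ih2 => exact .loop_step s t u e c (he.mono huv) hpos ih1 ih2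
  | call s t c src dst hsrc hdst harg _ hres ih =>
    exact .call s t c src dst (hsrc.mono huv) (hdst.mono huv) (harg.mono huv) ih (hres.mono huv)
  -- The remaining case is `loop_stop`.
  | _ s e c he hneg =>
    constructor
    exacts [he.mono huv, hneg]

/-- The program `c`, started in the state `s`, terminates in a state that satisfies `Q`. -/
def Terminates (w : ℕ) (c : Program) (s : State) (Q : State → Prop) : Prop :=
  ∃ t, Exec w c s t ∧ Q t

variable {w : ℕ} {s : State} {Q R : State → Prop} {c d : Program}

/-! ### Weakest-precondition rules for programs -/

theorem Terminates.imp (h : Terminates w c s Q) (hQR : ∀ t, Q t → R t) : Terminates w c s R := by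
  obtain ⟨t, ht, hQ⟩ := h
  exact ⟨t, ht, hQR t hQ⟩

theorem terminates_skip (h : Q s) : Terminates w .skip s Q := ⟨s, .skip s, h⟩

theorem terminates_assign {r : ℕ} {e : Exp} (he : e.Fits w s)
    (h : Q ((s.setReg r (e.eval s)).tick (e.cost + 1))) : Terminates w (.assign r e) s Q :=
  ⟨_, .assign s r e he, h⟩

theorem terminates_store {a e : Exp} (ha : a.Fits w s) (he : e.Fits w s)
    (h : Q ((s.setMem (a.addr s) (e.eval s)).tick (a.cost + e.cost + 1))) :
    Terminates w (.store a e) s Q :=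
  ⟨_, .store s a e ha he, h⟩

theorem terminates_seq (h : Terminates w c s fun t => Terminates w d t Q) :
    Terminates w (.seq c d) s Q := by
  obtain ⟨t, hc, u, hd, hu⟩ := h
  exact ⟨u, .seq s t u c d hc hd, hu⟩

theorem terminates_block_nil (h : Q s) : Terminates w (.block []) s Q := terminates_skip h

theorem terminates_block_cons {cs : List Program}
    (h : Terminates w c s fun t => Terminates w (.block cs) t Q) :
    Terminates w (.block (c :: cs)) s Q :=
  terminates_seq h

theorem terminates_ite {e : Exp} (he : e.Fits w s)
    (hpos : 0 < e.eval s → Terminates w c (s.tick (e.cost + 1)) Q)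
    (hneg : ¬ 0 < e.eval s → Terminates w d (s.tick (e.cost + 1)) Q) :
    Terminates w (.ite e c d) s Q := by
  by_cases h : 0 < e.eval s
  · obtain ⟨t, ht, hQ⟩ := hpos h
    exact ⟨t, .ite_pos s t e c d he h ht, hQ⟩
  · obtain ⟨t, ht, hQ⟩ := hneg h
    exact ⟨t, .ite_neg s t e c d he h ht, hQ⟩

theorem terminates_loop {e : Exp} (he : e.Fits w s)
    (hpos : 0 < e.eval s → Terminates w c (s.tick (e.cost + 1)) fun t =>
      Terminates w (.loop e c) t Q)
    (hneg : ¬ 0 < e.eval s → Q (s.tick (e.cost + 1))) :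
    Terminates w (.loop e c) s Q := by
  by_cases h : 0 < e.eval s
  · obtain ⟨t, ht, u, hu, hQ⟩ := hpos h
    exact ⟨u, .loop_step s t u e c he h ht hu, hQ⟩
  · refine ⟨s.tick (e.cost + 1), ?_, hneg h⟩
    constructor
    exacts [he, h]

end RAM

/-! ### Evaluation of expressions and points in registers and memory -/

namespace RAM

section Simp

variable (s : State) (r a t w : ℕ) (z : ℤ) (e f : Exp)

@[simp] theorem State.reg_tick : (s.tick t).reg = s.reg := rfl
@[simp] theorem State.mem_tick : (s.tick t).mem = s.mem := rfl
@[simp] theorem State.out_tick : (s.tick t).out = s.out := rfl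
@[simp] theorem State.clock_tick : (s.tick t).clock = s.clock + t := rfl
@[simp] theorem State.reg_setReg : (s.setReg r z).reg = Function.update s.reg r z := rfl
@[simp] theorem State.mem_setReg : (s.setReg r z).mem = s.mem := rfl
@[simp] theorem State.out_setReg : (s.setReg r z).out = s.out := rfl
@[simp] theorem State.clock_setReg : (s.setReg r z).clock = s.clock := rfl
@[simp] theorem State.reg_setMem : (s.setMem a z).reg = s.reg := rfl
@[simp] theorem State.mem_setMem : (s.setMem a z).mem = Function.update s.mem a z := rfl
@[simp] theorem State.out_setMem : (s.setMem a z).out = s.out := rfl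
@[simp] theorem State.clock_setMem : (s.setMem a z).clock = s.clock := rfl

@[simp] theorem Exp.eval_ofNat : (no_index (OfNat.ofNat r : Exp)).eval s = ((OfNat.ofNat r : ℕ) : ℤ) := rfl
@[simp] theorem Exp.eval_reg : (Exp.reg r).eval s = s.reg r := rfl
@[simp] theorem Exp.eval_load : (Exp.load e).eval s = s.mem (e.eval s).toNat := rfl
@[simp] theorem Exp.eval_add : (e + f).eval s = e.eval s + f.eval s := rfl
@[simp] theorem Exp.eval_sub : (e - f).eval s = e.eval s - f.eval s := rfl
@[simp] theorem Exp.eval_mul : (e * f).eval s = e.eval s * f.eval s := rfl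

@[simp] theorem Exp.cost_ofNat : (no_index (OfNat.ofNat r : Exp)).cost = 1 := rfl
@[simp] theorem Exp.cost_reg : (Exp.reg r).cost = 1 := rfl
@[simp] theorem Exp.cost_load : (Exp.load e).cost = e.cost + 1 := rfl
@[simp] theorem Exp.cost_add : (e + f).cost = e.cost + f.cost + 1 := rfl
@[simp] theorem Exp.cost_sub : (e - f).cost = e.cost + f.cost + 1 := rfl
@[simp] theorem Exp.cost_mul : (e * f).cost = e.cost + f.cost + 1 := rfl

@[simp] theorem Exp.fits_ofNat :
    (no_index (OfNat.ofNat r : Exp)).Fits w s ↔ FitsWord w ((OfNat.ofNat r : ℕ) : ℤ) := Iff.rfl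
@[simp] theorem Exp.fits_reg : (Exp.reg r).Fits w s ↔ FitsWord w (s.reg r) := Iff.rfl
@[simp] theorem Exp.fits_load :
    (Exp.load e).Fits w s ↔ e.Fits w s ∧ FitsWord w (s.mem (e.eval s).toNat) := Iff.rfl
@[simp] theorem Exp.fits_add : (e + f).Fits w s ↔
    e.Fits w s ∧ f.Fits w s ∧ FitsWord w (e.eval s + f.eval s) := Iff.rfl
@[simp] theorem Exp.fits_sub : (e - f).Fits w s ↔
    e.Fits w s ∧ f.Fits w s ∧ FitsWord w (e.eval s - f.eval s) := Iff.rfl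
@[simp] theorem Exp.fits_mul : (e * f).Fits w s ↔
    e.Fits w s ∧ f.Fits w s ∧ FitsWord w (e.eval s * f.eval s) := Iff.rfl

end Simp

theorem fitsWord_natCast {w n : ℕ} : FitsWord w (n : ℤ) ↔ n < 2 ^ w := by
  simp [FitsWord]

theorem terminates_assign_eq {w : ℕ} {s : State} {Q : State → Prop} {r : ℕ} {e : Exp} {z : ℤ}
    (he : e.Fits w s) (hz : e.eval s = z)
    (h : ∀ t : State, t.reg = Function.update s.reg r z → t.mem = s.mem → t.out = s.out →
      t.clock = s.clock + (e.cost + 1) → Q t) : Terminates w (.assign r e) s Q :=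
  terminates_assign he (h _ (by rw [← hz]; rfl) rfl rfl rfl)

theorem terminates_store_eq {w : ℕ} {s : State} {Q : State → Prop} {a e : Exp} {k : ℕ} {z : ℤ}
    (ha : a.Fits w s) (hk : a.eval s = k) (he : e.Fits w s) (hz : e.eval s = z)
    (h : ∀ t : State, t.mem = Function.update s.mem k z → t.reg = s.reg → t.out = s.out →
      t.clock = s.clock + (a.cost + e.cost + 1) → Q t) : Terminates w (.store a e) s Q :=
  terminates_store ha he (h _ (by simp [Exp.addr, hz, hk]) rfl rfl rfl)

theorem readBlock_eq {m : ℕ → ℤ} {a : ℕ} {v : List ℤ} (h0 : m a = v.length)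
    (h : ∀ i < v.length, m (a + 1 + i) = v.getD i 0) : readBlock m a = v := by
  apply List.ext_getElem
  · simp [readBlock, h0]
  · intro i h1 h2
    simp [readBlock, h i h2, h2]

theorem writeBlock_self (m : ℕ → ℤ) (a : ℕ) (v : List ℤ) : writeBlock m a v a = v.length := by
  simp [writeBlock]

theorem writeBlock_add (m : ℕ → ℤ) (a : ℕ) (v : List ℤ) {i : ℕ} (hi : i < v.length) :
    writeBlock m a v (a + 1 + i) = v.getD i 0 := by
  rw [writeBlock, if_neg (by omega), if_pos (by omega)]
  congr 1
  omega

theorem writeBlock_of_lt (m : ℕ → ℤ) {a : ℕ} (v : List ℤ) {i : ℕ} (hi : i < a) :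
    writeBlock m a v i = m i := by
  rw [writeBlock, if_neg (by omega), if_neg (by omega)]

theorem writeBlock_of_gt (m : ℕ → ℤ) {a : ℕ} (v : List ℤ) {i : ℕ} (hi : a + v.length < i) :
    writeBlock m a v i = m i := by
  rw [writeBlock, if_neg (by omega), if_neg (by omega)]

end RAM

namespace Dichotomic

open RAM RAM.Exp RAM.Program

/-- The point `y` is stored in the cells of `f` from `a` on. -/
def HasPoint (f : ℕ → ℤ) (a : ℕ) (y : Fin 2 → ℚ) : Prop :=
  ∀ j < 4, f (a + j) = (codePoint y).getD j 0

theorem HasPoint.congr {f g : ℕ → ℤ} {a c : ℕ} {y : Fin 2 → ℚ} (h : HasPoint f a y)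
    (hg : ∀ j < 4, g (c + j) = f (a + j)) : HasPoint g c y := fun j hj => by
  rw [hg j hj, h j hj]

section

variable {f : ℕ → ℤ} {a : ℕ} {y : Fin 2 → ℚ}

theorem HasPoint.num₀ (h : HasPoint f a y) : f a = (y 0).num := h 0 (by norm_num)
theorem HasPoint.den₀ (h : HasPoint f a y) : f (a + 1) = (y 0).den := h 1 (by norm_num)
theorem HasPoint.num₁ (h : HasPoint f a y) : f (a + 2) = (y 1).num := h 2 (by norm_num)
theorem HasPoint.den₁ (h : HasPoint f a y) : f (a + 3) = (y 1).den := h 3 (by norm_num)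

end

/-- All entries of the code of `y` have at most `b` bits. -/
def FitsPoint (b : ℕ) (y : Fin 2 → ℚ) : Prop :=
  ∀ i, FitsWord b (y i).num ∧ FitsWord b ((y i).den : ℤ)

theorem FitsPoint.getD {b : ℕ} {y : Fin 2 → ℚ} (h : FitsPoint b y) {j : ℕ} (hj : j < 4) :
    FitsWord b ((codePoint y).getD j 0) := by
  have h0 := h 0
  have h1 := h 1
  interval_cases j
  exacts [h0.1, h0.2, h1.1, h1.2]

theorem HasPoint.fits {f : ℕ → ℤ} {a b : ℕ} {y : Fin 2 → ℚ} (h : HasPoint f a y)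
    (hy : FitsPoint b y) {w : ℕ} (hw : b ≤ w) : ∀ j < 4, FitsWord w (f (a + j)) := fun j hj => by
  rw [h j hj]
  exact (hy.getD hj).mono hw

theorem forall_lt_four {p : ℕ → Prop} (h0 : p 0) (h1 : p 1) (h2 : p 2) (h3 : p 3) :
    ∀ j < 4, p j := by
  intro j hj
  interval_cases j <;> assumption

variable {w : ℕ} {s : State}

/-- The address expression is evaluated again for each of the four loads, after some target
registers have changed. Hence `ha` asks for its value in every state that agrees with `s` outside
the target. -/
theorem terminates_loadPoint {p k : ℕ} {a : Exp}
    (ha : ∀ t : State, (∀ r, r < p ∨ p + 4 ≤ r → t.reg r = s.reg r) →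
      a.Fits w t ∧ a.eval t = k)
    (hk : k + 4 < 2 ^ w) (hcost : a.cost ≤ 5) (hfits : ∀ j < 4, FitsWord w (s.mem (k + j))) :
    Terminates w (loadPoint p a) s fun t =>
      (∀ j < 4, t.reg (p + j) = s.mem (k + j)) ∧
      (∀ r, r < p ∨ p + 4 ≤ r → t.reg r = s.reg r) ∧
      t.mem = s.mem ∧ t.out = s.out ∧ t.clock ≤ s.clock + 40 := by
  have step : ∀ (i : ℕ) (t : State), t.mem = s.mem → a.Fits w t → a.eval t = k → i < 4 →
      FitsWord w i → (load (a + .const i)).Fits w t ∧ (load (a + .const i)).eval t = s.mem (k + i) := by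
    intro i t hmem he hv hi hiw
    have hn : ((k : ℤ) + i).toNat = k + i := by omega
    have hki : FitsWord w ((k : ℤ) + i) := by unfold FitsWord; omega
    have hc : (Exp.const i).eval t = i := rfl
    simp only [fits_load, fits_add, eval_load, eval_add, hv, hc, hn, hmem]
    exact ⟨⟨⟨he, hiw, hki⟩, hfits i hi⟩, trivial⟩
  have small : ∀ i : ℕ, i < 4 → FitsWord w i := fun i hi => by unfold FitsWord; omega
  obtain ⟨e0, v0⟩ := ha s fun _ _ => rfl
  refine terminates_block_cons (terminates_assign_eq (z := s.mem (k + 0)) ?_ ?_ ?_)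
  · simpa [e0, v0] using hfits 0 (by norm_num)
  · simp [v0]
  intro s1 r1 m1 o1 t1
  obtain ⟨e1, v1⟩ := ha s1 fun r hr => by
    rw [r1, Function.update_of_ne (by omega)]
  have h1 := step 1 s1 m1 e1 v1 (by norm_num) (small 1 (by norm_num))
  refine terminates_block_cons (terminates_assign_eq h1.1 h1.2 ?_)
  intro s2 r2 m2 o2 t2
  obtain ⟨e2, v2⟩ := ha s2 fun r hr => by
    rw [r2, Function.update_of_ne (by omega), r1, Function.update_of_ne (by omega)]
  have h2 := step 2 s2 (by rw [m2, m1]) e2 v2 (by norm_num) (small 2 (by norm_num))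
  refine terminates_block_cons (terminates_assign_eq h2.1 h2.2 ?_)
  intro s3 r3 m3 o3 t3
  obtain ⟨e3, v3⟩ := ha s3 fun r hr => by
    rw [r3, Function.update_of_ne (by omega), r2, Function.update_of_ne (by omega), r1,
      Function.update_of_ne (by omega)]
  have h3 := step 3 s3 (by rw [m3, m2, m1]) e3 v3 (by norm_num) (small 3 (by norm_num))
  refine terminates_block_cons (terminates_assign_eq h3.1 h3.2 ?_)
  intro s4 r4 m4 o4 t4
  refine terminates_block_nil ⟨?_, ?_, by rw [m4, m3, m2, m1], by rw [o4, o3, o2, o1], ?_⟩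
  · apply forall_lt_four <;> simp [r1, r2, r3, r4]
  · intro r hr
    rw [r4, Function.update_of_ne (by omega), r3, Function.update_of_ne (by omega), r2,
      Function.update_of_ne (by omega), r1, Function.update_of_ne (by omega)]
  · simp at t1 t2 t3 t4
    omega

theorem terminates_storePoint {p k : ℕ} {a : Exp}
    (ha : ∀ t : State, t.reg = s.reg → a.Fits w t ∧ a.eval t = k)
    (hk : k + 4 < 2 ^ w) (hcost : a.cost ≤ 5) (hfits : ∀ j < 4, FitsWord w (s.reg (p + j))) :
    Terminates w (storePoint a p) s fun t =>
      (∀ j < 4, t.mem (k + j) = s.reg (p + j)) ∧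
      (∀ i, i < k ∨ k + 4 ≤ i → t.mem i = s.mem i) ∧
      t.reg = s.reg ∧ t.out = s.out ∧ t.clock ≤ s.clock + 40 := by
  have step : ∀ (i : ℕ) (t : State), t.reg = s.reg → i < 4 →
      (a + .const i).Fits w t ∧ (a + .const i).eval t = (k + i : ℕ) ∧
      (reg (p + i)).Fits w t ∧ (reg (p + i)).eval t = s.reg (p + i) := by
    intro i t hreg hi
    obtain ⟨he, hv⟩ := ha t hreg
    have hki : FitsWord w ((k : ℤ) + i) := by unfold FitsWord; omega
    have hiw : FitsWord w i := by unfold FitsWord; omega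
    have hc : (Exp.const i).eval t = i := rfl
    simp only [fits_add, eval_add, hv, hc, fits_reg, eval_reg, hreg]
    exact ⟨⟨he, hiw, hki⟩, by push_cast; rfl, hfits i hi, trivial⟩
  obtain ⟨e0, v0⟩ := ha s rfl
  refine terminates_block_cons (terminates_store_eq (z := s.reg (p + 0)) e0 v0
    (by simpa using hfits 0 (by norm_num)) rfl ?_)
  intro s1 m1 r1 o1 t1
  obtain ⟨a1, b1, c1, d1⟩ := step 1 s1 r1 (by norm_num)
  refine terminates_block_cons (terminates_store_eq a1 b1 c1 d1 ?_)
  intro s2 m2 r2 o2 t2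
  obtain ⟨a2, b2, c2, d2⟩ := step 2 s2 (r2.trans r1) (by norm_num)
  refine terminates_block_cons (terminates_store_eq a2 b2 c2 d2 ?_)
  intro s3 m3 r3 o3 t3
  obtain ⟨a3, b3, c3, d3⟩ := step 3 s3 (r3.trans (r2.trans r1)) (by norm_num)
  refine terminates_block_cons (terminates_store_eq a3 b3 c3 d3 ?_)
  intro s4 m4 r4 o4 t4
  refine terminates_block_nil
    ⟨?_, ?_, by rw [r4, r3, r2, r1], by rw [o4, o3, o2, o1], ?_⟩
  · apply forall_lt_four <;> simp [m1, m2, m3, m4]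
  · intro i hi
    rw [m4, Function.update_of_ne (by omega), m3, Function.update_of_ne (by omega), m2,
      Function.update_of_ne (by omega), m1, Function.update_of_ne (by omega)]
  · simp at t1 t2 t3 t4
    omega

theorem terminates_copyPoint {p q : ℕ} (hpq : p + 4 ≤ q ∨ q + 4 ≤ p)
    (hfits : ∀ j < 4, FitsWord w (s.reg (q + j))) :
    Terminates w (copyPoint p q) s fun t =>
      (∀ j < 4, t.reg (p + j) = s.reg (q + j)) ∧
      (∀ r, r < p ∨ p + 4 ≤ r → t.reg r = s.reg r) ∧
      t.mem = s.mem ∧ t.out = s.out ∧ t.clock ≤ s.clock + 8 := by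
  have step : ∀ (i : ℕ) (t : State), t.reg (q + i) = s.reg (q + i) → i < 4 →
      (reg (q + i)).Fits w t ∧ (reg (q + i)).eval t = s.reg (q + i) := by
    intro i t hr hi
    simp only [fits_reg, eval_reg, hr]
    exact ⟨hfits i hi, trivial⟩
  refine terminates_block_cons (terminates_assign_eq (z := s.reg (q + 0))
    (by simpa using hfits 0 (by norm_num)) rfl ?_)
  intro s1 r1 m1 o1 t1
  have h1 := step 1 s1 (by rw [r1, Function.update_of_ne (by omega)]) (by norm_num)
  refine terminates_block_cons (terminates_assign_eq h1.1 h1.2 ?_)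
  intro s2 r2 m2 o2 t2
  have h2 := step 2 s2 (by rw [r2, Function.update_of_ne (by omega), r1,
    Function.update_of_ne (by omega)]) (by norm_num)
  refine terminates_block_cons (terminates_assign_eq h2.1 h2.2 ?_)
  intro s3 r3 m3 o3 t3
  have h3 := step 3 s3 (by rw [r3, Function.update_of_ne (by omega), r2,
    Function.update_of_ne (by omega), r1, Function.update_of_ne (by omega)]) (by norm_num)
  refine terminates_block_cons (terminates_assign_eq h3.1 h3.2 ?_)
  intro s4 r4 m4 o4 t4
  refine terminates_block_nil ⟨?_, ?_, by rw [m4, m3, m2, m1], by rw [o4, o3, o2, o1], ?_⟩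
  · apply forall_lt_four <;> simp [r1, r2, r3, r4]
  · intro r hr
    rw [r4, Function.update_of_ne (by omega), r3, Function.update_of_ne (by omega), r2,
      Function.update_of_ne (by omega), r1, Function.update_of_ne (by omega)]
  · simp at t1 t2 t3 t4
    omega

theorem terminates_outputPoint {p : ℕ} {Q : State → Prop}
    (hfits : ∀ j < 4, FitsWord w (s.reg (p + j))) {y : Fin 2 → ℚ} (hy : HasPoint s.reg p y)
    (h : Q { s with clock := s.clock + 5, out := s.out ++ [(codePoint y, s.clock + 5)] }) :
    Terminates w (outputPoint p) s Q := by
  refine ⟨_, .output s _ ?_, ?_⟩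
  · simp only [List.mem_cons, List.not_mem_nil, or_false, forall_eq_or_imp, forall_eq, fits_reg]
    exact ⟨hfits 0 (by norm_num), hfits 1 (by norm_num), hfits 2 (by norm_num),
      hfits 3 (by norm_num)⟩
  · simpa [codePoint, hy.num₀, hy.num₁, hy.den₀, hy.den₁] using h

theorem fits_square_sub {b w : ℕ} {r q : ℕ} (hr : FitsWord b (s.reg r))
    (hq : FitsWord b (s.reg q)) (hw : 2 * b + 2 ≤ w) : (square (reg r - reg q)).Fits w s ∧
      FitsWord (2 * b + 2) ((s.reg r - s.reg q) * (s.reg r - s.reg q)) := by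
  have h1 := hr.sub hq
  have h2 : FitsWord (2 * b + 2) ((s.reg r - s.reg q) * (s.reg r - s.reg q)) :=
    (h1.mul h1).mono (by omega)
  refine ⟨?_, h2⟩
  simp only [square, fits_mul, fits_sub, fits_reg, eval_sub, eval_reg]
  have h3 := hr.mono (show b ≤ w by omega)
  have h4 := hq.mono (show b ≤ w by omega)
  have h5 := h1.mono (show b + 1 ≤ w by omega)
  exact ⟨⟨h3, h4, h5⟩, ⟨h3, h4, h5⟩, h2.mono hw⟩

/-- A sum of squares vanishes only if every term does, and codes in lowest terms determine the
point. Each square has `2 * b + 2` bits and the three additions cost one bit each. -/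
theorem different_spec {p q b w : ℕ} {y z : Fin 2 → ℚ} (hp : HasPoint s.reg p y)
    (hq : HasPoint s.reg q z) (hy : FitsPoint b y) (hz : FitsPoint b z) (hw : 2 * b + 5 ≤ w) :
    (different p q).Fits w s ∧ FitsWord (2 * b + 5) ((different p q).eval s) ∧
      0 ≤ (different p q).eval s ∧ (0 < (different p q).eval s ↔ y ≠ z) := by
  have g : ∀ j < 4, _ := fun j hj => fits_square_sub (w := w)
    (hp.fits hy le_rfl j hj) (hq.fits hz le_rfl j hj) (by omega)
  obtain ⟨a0, b0⟩ := g 0 (by norm_num)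
  obtain ⟨a1, b1⟩ := g 1 (by norm_num)
  obtain ⟨a2, b2⟩ := g 2 (by norm_num)
  obtain ⟨a3, b3⟩ := g 3 (by norm_num)
  simp only [add_zero] at a0 b0
  have d1 := b0.add b1
  have d2 := d1.add (b2.mono (by omega))
  have d3 := d2.add (b3.mono (by omega))
  have heval : (different p q).eval s = (s.reg p - s.reg q) * (s.reg p - s.reg q) +
      (s.reg (p + 1) - s.reg (q + 1)) * (s.reg (p + 1) - s.reg (q + 1)) +
      (s.reg (p + 2) - s.reg (q + 2)) * (s.reg (p + 2) - s.reg (q + 2)) +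
      (s.reg (p + 3) - s.reg (q + 3)) * (s.reg (p + 3) - s.reg (q + 3)) := rfl
  have m0 := mul_self_nonneg (s.reg p - s.reg q)
  have m1 := mul_self_nonneg (s.reg (p + 1) - s.reg (q + 1))
  have m2 := mul_self_nonneg (s.reg (p + 2) - s.reg (q + 2))
  have m3 := mul_self_nonneg (s.reg (p + 3) - s.reg (q + 3))
  refine ⟨?_, by rw [heval]; exact d3, by rw [heval]; omega, ?_⟩
  · simp only [different, fits_add, eval_add]
    exact ⟨⟨⟨a0, a1, d1.mono (by omega)⟩, a2, d2.mono (by omega)⟩, a3, d3.mono (by omega)⟩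
  · constructor
    · rintro h rfl
      simp [heval, hp.num₀, hp.den₀, hp.num₁, hp.den₁, hq.num₀, hq.den₀, hq.num₁, hq.den₁] at h
    · intro hne
      by_contra hle
      apply hne
      apply codePoint_injective
      rw [heval] at hle
      have e0 := mul_self_eq_zero.1 (le_antisymm (show _ ≤ (0 : ℤ) by omega) m0)
      have e1 := mul_self_eq_zero.1 (le_antisymm (show _ ≤ (0 : ℤ) by omega) m1)
      have e2 := mul_self_eq_zero.1 (le_antisymm (show _ ≤ (0 : ℤ) by omega) m2)
      have e3 := mul_self_eq_zero.1 (le_antisymm (show _ ≤ (0 : ℤ) by omega) m3)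
      rw [hp.num₀, hq.num₀] at e0
      rw [hp.den₀, hq.den₀] at e1
      rw [hp.num₁, hq.num₁] at e2
      rw [hp.den₁, hq.den₁] at e3
      simp only [codePoint, sub_eq_zero.1 e0, sub_eq_zero.1 e1, sub_eq_zero.1 e2,
        sub_eq_zero.1 e3]

theorem terminates_absolute {r : ℕ} {Q : State → Prop} (h0 : FitsWord w 0)
    (hr : FitsWord w (s.reg r))
    (h : ∀ t : State, t.reg = Function.update s.reg r |s.reg r| → t.mem = s.mem → t.out = s.out →
      t.clock ≤ s.clock + 8 → Q t) : Terminates w (absolute r) s Q := by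
  have hneg : FitsWord w (0 - s.reg r) := by
    unfold FitsWord at *
    omega
  have hfits : (0 - reg r).Fits w s := ⟨h0, hr, hneg⟩
  refine terminates_ite hfits (fun hpos => terminates_assign ?_ (h _ ?_ rfl rfl ?_))
    (fun hle => terminates_skip (h _ ?_ rfl rfl ?_))
  · exact hfits
  · simp at hpos
    simp [abs_of_neg hpos]
  · simp
  · simp at hle
    simp [abs_of_nonneg hle]
  · simp

end Dichotomic

/-! ### Correctness of the subroutines -/

namespace RAM

theorem terminates_call_eq {w k : ℕ} {s t : State} {Q : State → Prop} {c : Program}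
    {src dst : Exp} {v : List ℤ} (hsrc : src.Fits w s) (hdst : dst.Fits w s)
    (hread : readBlock s.mem (src.addr s) = v) (hv : FitsBlock w v) (hk : dst.eval s = k)
    (hc : Exec w c (State.start v) t) (hres : FitsBlock w t.result)
    (h : ∀ s' : State, s'.reg = s.reg → s'.mem = writeBlock s.mem k t.result → s'.out = s.out →
      s'.clock = s.clock + (src.cost + dst.cost + 1 + v.length + t.clock + t.result.length) →
      Q s') : Terminates w (.call c src dst) s Q := by
  subst hread
  refine ⟨_, .call s t c src dst hsrc hdst hv hc hres, h _ rfl ?_ rfl rfl⟩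
  simp [Exp.addr, hk]

end RAM

namespace Dichotomic

open RAM RAM.Exp RAM.Program

variable {w b : ℕ} {s : State}

/-- The code pattern shared by both weights, followed by an arbitrary continuation `cs`. The cross
difference has `2 * b + 1` bits and the product of denominators `2 * b`, whence `4 * b + 1`. -/
theorem terminates_weight {r i₁ i₂ i₃ i₄ i₅ i₆ : ℕ} {cs : List Program} {Q : State → Prop}
    (hr : r ≠ i₅ ∧ r ≠ i₆)
    (h₁ : FitsWord b (s.reg i₁)) (h₂ : FitsWord b (s.reg i₂)) (h₃ : FitsWord b (s.reg i₃))
    (h₄ : FitsWord b (s.reg i₄)) (h₅ : FitsWord b (s.reg i₅)) (h₆ : FitsWord b (s.reg i₆))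
    (hw : 4 * b + 1 ≤ w)
    (h : ∀ t : State, t.reg = Function.update s.reg r
        (|s.reg i₁ * s.reg i₂ - s.reg i₃ * s.reg i₄| * (s.reg i₅ * s.reg i₆)) →
      t.mem = s.mem → t.out = s.out → t.clock ≤ s.clock + 30 →
      Terminates w (block cs) t Q) :
    Terminates w (block (assign r (reg i₁ * reg i₂ - reg i₃ * reg i₄) :: absolute r ::
      assign r (reg r * (reg i₅ * reg i₆)) :: cs)) s Q := by
  have m₁ := h₁.mul h₂
  have m₂ := h₃.mul h₄
  have m₃ := h₅.mul h₆
  have d := m₁.sub m₂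
  have hbw : b ≤ w := by omega
  have hbw2 : b + b ≤ w := by omega
  refine terminates_block_cons (terminates_assign_eq (z := _) ?_ rfl ?_)
  · simp only [fits_sub, fits_mul, fits_reg, eval_mul, eval_reg]
    exact ⟨⟨h₁.mono hbw, h₂.mono hbw, m₁.mono hbw2⟩,
      ⟨h₃.mono hbw, h₄.mono hbw, m₂.mono hbw2⟩, d.mono (by omega)⟩
  intro s1 r1 m1 o1 t1
  refine terminates_block_cons (terminates_absolute (by simp [FitsWord]) ?_ ?_)
  · rw [r1, Function.update_self]
    exact d.mono (by omega)
  intro s2 r2 m2 o2 t2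
  have hval : s2.reg r = |s.reg i₁ * s.reg i₂ - s.reg i₃ * s.reg i₄| := by
    simp [r2, r1]
  have hne : ∀ j, r ≠ j → s2.reg j = s.reg j := fun j hj => by
    simp [r2, r1, hj.symm]
  refine terminates_block_cons (terminates_assign_eq (z := _) ?_ rfl ?_)
  · simp only [fits_mul, fits_reg, eval_mul, eval_reg, hval, hne _ hr.1, hne _ hr.2]
    exact ⟨d.abs.mono (by omega), ⟨h₅.mono hbw, h₆.mono hbw, m₃.mono hbw2⟩,
      (d.abs.mul m₃).mono (by omega)⟩
  intro s3 r3 m3 o3 t3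
  refine h s3 ?_ (by rw [m3, m2, m1]) (by rw [o3, o2, o1]) ?_
  · rw [r3, r2, r1, Function.update_idem, Function.update_idem]
    simp only [eval_mul, eval_reg, hval, hne _ hr.1, hne _ hr.2]
  · simp at t1 t2 t3
    omega

theorem abs_cross_mul (x y : ℚ) : |((x.num * y.den - y.num * x.den : ℤ) : ℚ)| =
    |x - y| * (x.den * y.den) := by
  have hx := Rat.mul_den_eq_num x
  have hy := Rat.mul_den_eq_num y
  have hpos : (0 : ℚ) ≤ (x.den : ℚ) * y.den := by positivity
  rw [← abs_of_nonneg hpos, ← abs_mul]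
  congr 1
  push_cast
  rw [← hx, ← hy]
  ring

theorem terminates_computeWeights {p q : ℕ} {y z : Fin 2 → ℚ} (hp5 : 5 ≤ p) (hq5 : 5 ≤ q)
    (hp : HasPoint s.reg p y) (hq : HasPoint s.reg q z) (hy : FitsPoint b y) (hz : FitsPoint b z)
    (hw : 4 * b + 1 ≤ w) :
    Terminates w (computeWeights p q) s fun t =>
      (∃ k l : ℤ, t.reg rW₁ = k ∧ t.reg rW₂ = l ∧ 0 ≤ k ∧ 0 ≤ l ∧ FitsWord (4 * b + 1) k ∧
        FitsWord (4 * b + 1) l ∧ ∃ d : ℚ, 0 < d ∧ (k : ℚ) = |y 1 - z 1| * d ∧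
          (l : ℚ) = |y 0 - z 0| * d) ∧
      (∀ r, r ≠ rW₁ → r ≠ rW₂ → t.reg r = s.reg r) ∧
      t.mem = s.mem ∧ t.out = s.out ∧ t.clock ≤ s.clock + 60 := by
  have fp := hp.fits hy le_rfl
  have fq := hq.fits hz le_rfl
  have fp0 : FitsWord b (s.reg p) := fp 0 (by norm_num)
  have fq0 : FitsWord b (s.reg q) := fq 0 (by norm_num)
  have fp1 := fp 1 (by norm_num)
  have fq1 := fq 1 (by norm_num)
  have fp2 := fp 2 (by norm_num)
  have fq2 := fq 2 (by norm_num)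
  have fp3 := fp 3 (by norm_num)
  have fq3 := fq 3 (by norm_num)
  refine terminates_weight (by simp only [rW₁]; omega) fp2 fq3 fq2 fp3 fp1 fq1 hw ?_
  intro t r1 m1 o1 t1
  have hne : ∀ j, j ≠ rW₁ → t.reg j = s.reg j := fun j hj => by simp [r1, hj]
  have e0 := hne p (by simp only [rW₁]; omega)
  have e1 := hne (p + 1) (by simp only [rW₁]; omega)
  have e3 := hne (p + 3) (by simp only [rW₁]; omega)
  have g0 := hne q (by simp only [rW₁]; omega)
  have g1 := hne (q + 1) (by simp only [rW₁]; omega)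
  have g3 := hne (q + 3) (by simp only [rW₁]; omega)
  refine terminates_weight (by simp only [rW₂]; omega) (by rwa [e0]) (by rwa [g1]) (by rwa [g0])
    (by rwa [e1]) (by rwa [e3]) (by rwa [g3]) hw ?_
  intro t' r2 m2 o2 t2
  rw [e0, e1, e3, g0, g1, g3] at r2
  refine terminates_block_nil ⟨⟨_, _, rfl, rfl, ?_⟩, ?_, by rw [m2, m1], by rw [o2, o1], by omega⟩
  · have v1 : t'.reg rW₁ = |s.reg (p + 2) * s.reg (q + 3) - s.reg (q + 2) * s.reg (p + 3)| *
        (s.reg (p + 1) * s.reg (q + 1)) := by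
      rw [r2, Function.update_of_ne (by simp [rW₁, rW₂]), r1, Function.update_self]
    have v2 : t'.reg rW₂ = |s.reg p * s.reg (q + 1) - s.reg q * s.reg (p + 1)| *
        (s.reg (p + 3) * s.reg (q + 3)) := by
      rw [r2, Function.update_self]
    have b1 := (((fp2.mul fq3).sub (fq2.mul fp3)).abs.mul (fp1.mul fq1)).mono
      (show _ ≤ 4 * b + 1 by omega)
    have b2 := (((fp0.mul fq1).sub (fq0.mul fp1)).abs.mul (fp3.mul fq3)).mono
      (show _ ≤ 4 * b + 1 by omega)
    rw [v1, v2]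
    rw [hp.num₀, hp.num₁, hp.den₀, hp.den₁, hq.num₀, hq.num₁, hq.den₀, hq.den₁] at *
    -- The common factor `d` is the product of all four denominators: each cross difference supplies
    -- those of its own coordinate, and the multiplication supplies those of the other.
    refine ⟨by positivity, by positivity, b1, b2,
      (y 1).den * (z 1).den * ((y 0).den * (z 0).den), ?_, ?_, ?_⟩
    · have := (y 0).den_pos
      have := (y 1).den_pos
      have := (z 0).den_pos
      have := (z 1).den_pos
      positivity
    · rw [Int.cast_mul, Int.cast_abs, abs_cross_mul]
      push_cast
      ring
    · rw [Int.cast_mul, Int.cast_abs, abs_cross_mul]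
      push_cast
      ring
  · intro r h1 h2
    rw [r2, Function.update_of_ne h2, r1, Function.update_of_ne h1]

/-- The program `A` solves the lexicographic weighted-sum problems of the instance `I` with code
`u` in time `D`, for weights with at most `4 * b + 1` bits, where `b` bounds the number of bits of
the coordinates of points; words have `w` bits, which is large enough for the variant. -/
structure Oracle (I : BOCOInstance) (A : Program) (u : List ℤ) (w b D : ℕ) : Prop where
  fits_points : ∀ y ∈ I.points, FitsPoint b y
  fits_input : FitsBlock w u
  one_le : 1 ≤ b
  le_word : 4 * b + 10 ≤ w
  addr_lt : u.length + 100 + 24 * 2 ^ I.n < 2 ^ w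
  solve : ∀ k l : ℤ, 0 ≤ k → 0 ≤ l → FitsWord (4 * b + 1) k → FitsWord (4 * b + 1) l →
    ∃ t, Exec w A (State.start (u ++ [k, 1, l, 1])) t ∧ t.clock ≤ D ∧
      ((I.S = ∅ ∧ t.result = []) ∨
        ∃ y, I.IsLexOptimal ![(k : ℚ), (l : ℚ)] y ∧ t.result = codePoint y)

/-- The register `rN` and the argument block are set up for the input `u`. -/
structure Ready (u : List ℤ) (s : State) : Prop where
  reg_rN : s.reg rN = u.length
  mem_zero : s.mem 0 = (u.length + 4 : ℕ)
  mem_input : ∀ i < u.length, s.mem (1 + i) = u.getD i 0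

theorem Ready.congr {u : List ℤ} {s t : State} (h : Ready u s) (hreg : t.reg rN = s.reg rN)
    (hmem : ∀ i ≤ u.length, t.mem i = s.mem i) : Ready u t :=
  ⟨by rw [hreg, h.reg_rN], by rw [hmem 0 (Nat.zero_le _), h.mem_zero],
    fun i hi => by rw [hmem _ (by omega), h.mem_input i hi]⟩

variable {I : BOCOInstance} {A : Program} {u : List ℤ} {D : ℕ}

/-- The result block starts behind the argument block and ends before the queue, so `Ready` and the
queue survive the call. The hypothesis `hempty` is needed because the program loads a point even
when the result is empty: it then reads old cells, which must fit into a word. -/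
theorem terminates_solveLex (hO : Oracle I A u w b D) (hs : Ready u s) {k l : ℤ}
    (hk : s.reg rW₁ = k) (hl : s.reg rW₂ = l) (hk0 : 0 ≤ k) (hl0 : 0 ≤ l)
    (hkb : FitsWord (4 * b + 1) k) (hlb : FitsWord (4 * b + 1) l)
    (hempty : I.S = ∅ → ∀ j < 4, s.mem (u.length + 6 + j) = 0) :
    Terminates w (solveLex A) s fun t =>
      ((I.S = ∅ ∧ t.mem (u.length + 5) = 0) ∨
        ∃ y, I.IsLexOptimal ![(k : ℚ), (l : ℚ)] y ∧ t.mem (u.length + 5) = 4 ∧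
          HasPoint t.reg rZ y) ∧
      Ready u t ∧
      (∀ r, r < rZ ∨ rZ + 4 ≤ r → t.reg r = s.reg r) ∧
      (∀ i, u.length + 10 ≤ i → t.mem i = s.mem i) ∧
      t.out = s.out ∧ t.clock ≤ s.clock + (D + u.length + 100) := by
  have haddr := hO.addr_lt
  have hkw := hkb.mono (show _ ≤ w by have := hO.le_word; omega)
  have hlw := hlb.mono (show _ ≤ w by have := hO.le_word; omega)
  have small : ∀ i : ℕ, i < 100 → FitsWord w i := fun i hi => by unfold FitsWord; omega
  have addr : ∀ (i : ℕ) (t : State), t.reg = s.reg → i < 100 →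
      (reg rN + .const i).Fits w t ∧ (reg rN + .const i).eval t = (u.length + i : ℕ) := by
    intro i t hreg hi
    have hc : (Exp.const i).eval t = i := rfl
    simp only [fits_add, eval_add, hc, fits_reg, eval_reg, hreg, hs.reg_rN]
    refine ⟨⟨?_, small i hi, ?_⟩, by push_cast; rfl⟩
    · rw [fitsWord_natCast]; omega
    · rw [← Nat.cast_add, fitsWord_natCast]; omega
  have a1 := addr 1 s rfl (by norm_num)
  refine terminates_block_cons (terminates_store_eq a1.1 a1.2 (z := k) ?_ hk ?_)
  · simpa [hk] using hkw
  intro s1 m1 r1 o1 t1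
  have a2 := addr 2 s1 r1 (by norm_num)
  refine terminates_block_cons (terminates_store_eq a2.1 a2.2 (z := 1) (small 1 (by norm_num))
    rfl ?_)
  intro s2 m2 r2 o2 t2
  rw [r1] at r2
  have a3 := addr 3 s2 r2 (by norm_num)
  refine terminates_block_cons (terminates_store_eq a3.1 a3.2 (z := l) ?_ ?_ ?_)
  · simpa [r2, hl] using hlw
  · simpa [r2] using hl
  intro s3 m3 r3 o3 t3
  rw [r2] at r3
  have a4 := addr 4 s3 r3 (by norm_num)
  refine terminates_block_cons (terminates_store_eq a4.1 a4.2 (z := 1) (small 1 (by norm_num))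
    rfl ?_)
  intro s4 m4 r4 o4 t4
  rw [r3] at r4
  have hmem4 : ∀ i, i ≤ u.length ∨ u.length + 5 ≤ i → s4.mem i = s.mem i := by
    intro i hi
    rw [m4, Function.update_of_ne (by omega), m3, Function.update_of_ne (by omega), m2,
      Function.update_of_ne (by omega), m1, Function.update_of_ne (by omega)]
  obtain ⟨t, ht, htD, hres⟩ := hO.solve k l hk0 hl0 hkb hlb
  have hread : readBlock s4.mem (Exp.addr s4 0) = u ++ [k, 1, l, 1] := by
    have h0 : Exp.addr s4 0 = 0 := rfl
    rw [h0]
    apply readBlock_eq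
    · rw [hmem4 0 (by omega), hs.mem_zero]
      simp
    · intro i hi
      rw [List.length_append] at hi
      rcases lt_or_ge i u.length with h | h
      · rw [List.getD_append _ _ _ _ h, hmem4 _ (by omega), ← hs.mem_input i h]
      · obtain ⟨j, rfl⟩ := Nat.exists_eq_add_of_le h
        rw [List.getD_append_right _ _ _ _ h, Nat.add_sub_cancel_left,
          show 0 + 1 + (u.length + j) = u.length + (j + 1) by omega]
        have hj : j < 4 := by simpa using hi
        clear hi h
        interval_cases j <;> simp [m1, m2, m3, m4]
  have hblock : FitsBlock w (u ++ [k, 1, l, 1]) := by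
    refine ⟨?_, ?_⟩
    · rw [fitsWord_natCast, List.length_append]
      simp
      omega
    · intro z hz
      rw [List.mem_append] at hz
      rcases hz with hz | hz
      · exact hO.fits_input.2 z hz
      · have h1 := small 1 (by norm_num)
        simp only [List.mem_cons, List.not_mem_nil, or_false] at hz
        rcases hz with rfl | rfl | rfl | rfl
        exacts [hkw, h1, hlw, h1]
  have hpt : ∀ y ∈ I.points, ∀ j < 4, FitsWord w ((codePoint y).getD j 0) := fun y hy j hj =>
    ((hO.fits_points y hy).getD hj).mono (by have := hO.le_word; omega)
  have hlen : t.result.length ≤ 4 := by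
    rcases hres with ⟨-, h⟩ | ⟨y, -, h⟩ <;> simp [h, codePoint]
  have hresFits : FitsBlock w t.result := by
    refine ⟨small _ (by omega), ?_⟩
    rcases hres with ⟨-, h⟩ | ⟨y, hy, h⟩
    · simp [h]
    · intro z hz
      rw [h] at hz
      obtain ⟨j, hj, rfl⟩ := List.getElem_of_mem hz
      have := hpt y hy.1 j (by simpa [codePoint] using hj)
      rwa [List.getD_eq_getElem _ _ hj] at this
  have a5 := addr 5 s4 r4 (by norm_num)
  refine terminates_block_cons (terminates_call_eq (small 0 (by norm_num)) a5.1 hread hblock a5.2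
    ht hresFits ?_)
  intro s5 r5 m5 o5 t5
  rw [r4] at r5
  have hcell : ∀ j < 4, FitsWord w (s5.mem (u.length + 6 + j)) := by
    intro j hj
    rcases hres with ⟨hS, h⟩ | ⟨y, hy, h⟩
    · rw [m5, writeBlock_of_gt _ _ (by simp [h]; omega), hmem4 _ (by omega), hempty hS j hj]
      exact small 0 (by norm_num)
    · rw [m5, show u.length + 6 + j = u.length + 5 + 1 + j by omega,
        writeBlock_add _ _ _ (by simp [h, codePoint]; omega), h]
      exact hpt y hy.1 j hj
  refine terminates_block_cons ((terminates_loadPoint (k := u.length + 6) ?_ (by omega) (by simp)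
    hcell).imp ?_)
  · intro s' hs'
    have hN : s'.reg rN = u.length := by
      rw [hs' rN (by simp [rN, rZ]), r5, hs.reg_rN]
    simp only [fits_add, eval_add, fits_reg, eval_reg, hN, fits_ofNat, eval_ofNat]
    refine ⟨⟨?_, small 6 (by norm_num), ?_⟩, by push_cast; rfl⟩
    · rw [fitsWord_natCast]; omega
    · rw [← Nat.cast_add, fitsWord_natCast]; omega
  · rintro s6 ⟨p6, r6, m6, o6, t6⟩
    refine terminates_block_nil ⟨?_, hs.congr ?_ ?_, ?_, ?_, ?_, ?_⟩
    · rcases hres with ⟨hS, h⟩ | ⟨y, hy, h⟩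
      · refine .inl ⟨hS, ?_⟩
        rw [m6, m5, writeBlock_self, h]
        simp
      · refine .inr ⟨y, hy, ?_, ?_⟩
        · rw [m6, m5, writeBlock_self, h]
          simp [codePoint]
        · intro j hj
          rw [p6 j hj, m5, show u.length + 6 + j = u.length + 5 + 1 + j by omega,
            writeBlock_add _ _ _ (by simp [h, codePoint]; omega), h]
    · rw [r6 _ (by simp [rN, rZ]), r5]
    · intro i hi
      rw [m6, m5, writeBlock_of_lt _ _ (by omega), hmem4 i (by omega)]
    · intro r hr
      rw [r6 r hr, r5]
    · intro i hi
      rw [m6, m5, writeBlock_of_gt _ _ (by omega), hmem4 i (by omega)]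
    · rw [o6, o5, o4, o3, o2, o1]
    · simp [Exp.cost] at t1 t2 t3 t4 t5
      omega

end Dichotomic

/-! ### The queue and the examination of a pair of points -/

open BOCOInstance

instance {p q : Fin 2 → ℚ} : DecidablePred (Between p q) := fun _ =>
  inferInstanceAs (Decidable (_ ∨ _))

namespace Dichotomic

open RAM RAM.Exp RAM.Program

/-- A triple `(y, y², y³)` of points. -/
abbrev Triple := (Fin 2 → ℚ) × (Fin 2 → ℚ) × (Fin 2 → ℚ)

/-- The triple `t` is stored from address `a` on. -/
def HasTriple (m : ℕ → ℤ) (a : ℕ) (t : Triple) : Prop :=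
  HasPoint m a t.1 ∧ HasPoint m (a + 4) t.2.1 ∧ HasPoint m (a + 8) t.2.2

/-- The triples in the list `Q` are stored consecutively from address `a` on. -/
def HasQueue (m : ℕ → ℤ) (a : ℕ) (Q : List Triple) : Prop :=
  ∀ i (h : i < Q.length), HasTriple m (a + 12 * i) Q[i]

theorem HasTriple.congr {m m' : ℕ → ℤ} {a : ℕ} {t : Triple} (h : HasTriple m a t)
    (hm : ∀ i, a ≤ i → i < a + 12 → m' i = m i) : HasTriple m' a t :=
  ⟨h.1.congr fun j hj => hm _ (by omega) (by omega),
    h.2.1.congr fun j hj => hm _ (by omega) (by omega),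
    h.2.2.congr fun j hj => hm _ (by omega) (by omega)⟩

theorem HasQueue.congr {m m' : ℕ → ℤ} {a : ℕ} {Q : List Triple} (h : HasQueue m a Q)
    (hm : ∀ i, a ≤ i → i < a + 12 * Q.length → m' i = m i) : HasQueue m' a Q := fun i hi =>
  (h i hi).congr fun k _ _ => hm k (by omega) (by omega)

theorem HasQueue.append {m : ℕ → ℤ} {a : ℕ} {Q : List Triple} {t : Triple} (h : HasQueue m a Q)
    (ht : HasTriple m (a + 12 * Q.length) t) : HasQueue m a (Q ++ [t]) := by
  intro i hi
  rcases lt_or_ge i Q.length with h' | h'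
  · rw [List.getElem_append_left h']
    exact h i h'
  · have : i = Q.length := by simp at hi; omega
    subst this
    simpa using ht

theorem HasQueue.tail {m : ℕ → ℤ} {a : ℕ} {Q : List Triple} {t : Triple}
    (h : HasQueue m a (t :: Q)) : HasTriple m a t ∧ HasQueue m (a + 12) Q := by
  refine ⟨h 0 (by simp), fun i hi => ?_⟩
  have := h (i + 1) (by simpa using hi)
  rwa [List.getElem_cons_succ, show a + 12 * (i + 1) = a + 12 + 12 * i by ring] at this

variable {w b : ℕ} {s : State} {I : BOCOInstance} {A : Program} {u : List ℤ} {D : ℕ}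

/-- Only cells from the old tail `T` on change, so earlier triples remain intact. -/
theorem terminates_enqueue {p q T : ℕ} {x y z : Fin 2 → ℚ} (hp : HasPoint s.reg p y)
    (hq : HasPoint s.reg q z) (hZ : HasPoint s.reg rZ x) (hx : FitsPoint b x)
    (hy : FitsPoint b y) (hz : FitsPoint b z) (hw : b ≤ w) (hT : s.reg rTail = T)
    (hTw : T + 20 < 2 ^ w) :
    Terminates w (block [storePoint (reg rTail) rZ, storePoint (reg rTail + 4) p,
        storePoint (reg rTail + 8) q, assign rTail (reg rTail + 12)]) s fun t =>
      HasTriple t.mem T (x, y, z) ∧ t.reg rTail = (T + 12 : ℕ) ∧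
      (∀ r, r ≠ rTail → t.reg r = s.reg r) ∧ (∀ i < T, t.mem i = s.mem i) ∧
      t.out = s.out ∧ t.clock ≤ s.clock + 130 := by
  have addr : ∀ (i : ℕ) (t : State), t.reg = s.reg → i < 20 →
      (reg rTail + .const i).Fits w t ∧ (reg rTail + .const i).eval t = (T + i : ℕ) := by
    intro i t hreg hi
    have hc : (Exp.const i).eval t = i := rfl
    simp only [fits_add, eval_add, hc, fits_reg, eval_reg, hreg, hT]
    refine ⟨⟨?_, (fitsWord_natCast.2 (by omega) : FitsWord w i), ?_⟩, by push_cast; rfl⟩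
    · rw [fitsWord_natCast]; omega
    · rw [← Nat.cast_add, fitsWord_natCast]; omega
  refine terminates_block_cons ((terminates_storePoint (k := T) ?_ (by omega) (by simp)
    (hZ.fits hx hw)).imp ?_)
  · intro t ht
    simp only [fits_reg, eval_reg, ht, hT, fitsWord_natCast]
    exact ⟨by omega, trivial⟩
  rintro s1 ⟨p1, n1, r1, o1, t1⟩
  refine terminates_block_cons ((terminates_storePoint (k := T + 4)
    (fun t ht => addr 4 t (ht.trans r1) (by norm_num)) (by omega) (by simp [Exp.cost]) ?_).imp ?_)
  · rw [r1]
    exact hp.fits hy hw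
  rintro s2 ⟨p2, n2, r2, o2, t2⟩
  rw [r1] at r2 p2
  refine terminates_block_cons ((terminates_storePoint (k := T + 8)
    (fun t ht => addr 8 t (ht.trans r2) (by norm_num)) (by omega) (by simp [Exp.cost]) ?_).imp ?_)
  · rw [r2]
    exact hq.fits hz hw
  rintro s3 ⟨p3, n3, r3, o3, t3⟩
  rw [r2] at r3 p3
  have a4 := addr 12 s3 r3 (by norm_num)
  refine terminates_block_cons (terminates_assign_eq a4.1 a4.2 ?_)
  intro s4 r4 m4 o4 t4
  refine terminates_block_nil ⟨⟨?_, ?_, ?_⟩, ?_, ?_, ?_, by rw [o4, o3, o2, o1], ?_⟩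
  · refine hZ.congr fun j hj => ?_
    rw [m4, n3 _ (by omega), n2 _ (by omega), p1 j hj]
  · refine hp.congr fun j hj => ?_
    rw [m4, n3 _ (by omega), p2 j hj]
  · refine hq.congr fun j hj => ?_
    rw [m4, p3 j hj]
  · rw [r4, Function.update_self]
  · intro r hr
    rw [r4, Function.update_of_ne hr, r3]
  · intro i hi
    rw [m4, n3 _ (by omega), n2 _ (by omega), n1 _ (by omega)]
  · simp at t4
    omega

/-- Registers that are not changed by the examination of a pair of points. -/
def Preserved (r : ℕ) : Prop := r < 2 ∨ 5 ≤ r ∧ r < 40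

theorem HasPoint.preserved {f g : ℕ → ℤ} {p : ℕ} {y : Fin 2 → ℚ} (h : HasPoint f p y)
    (hp : 5 ≤ p ∧ p < 37) (hg : ∀ r, Preserved r → g r = f r) : HasPoint g p y :=
  h.congr fun j hj => hg _ (.inr ⟨by omega, by omega⟩)

theorem terminates_examine (hO : Oracle I A u w b D) (hs : Ready u s) {p q T : ℕ}
    {y z : Fin 2 → ℚ} (hp5 : 5 ≤ p ∧ p < 37) (hq5 : 5 ≤ q ∧ q < 37)
    (hp : HasPoint s.reg p y) (hq : HasPoint s.reg q z)
    (hy : y ∈ I.extremes) (hz : z ∈ I.extremes) (hyz : y ≠ z) (hT : s.reg rTail = T)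
    (hTN : u.length + 10 ≤ T) (hTw : T + 20 < 2 ^ w) :
    Terminates w (examine A p q) s fun t =>
      ((t.reg rTail = T ∧ ∀ x ∈ I.extremes, ¬ Between y z x) ∨
        ∃ x ∈ I.extremes, Between y z x ∧ t.reg rTail = (T + 12 : ℕ) ∧
          HasTriple t.mem T (x, y, z)) ∧
      Ready u t ∧ (∀ r, Preserved r → t.reg r = s.reg r) ∧
      (∀ i, u.length + 10 ≤ i → i < T → t.mem i = s.mem i) ∧
      t.out = s.out ∧ t.clock ≤ s.clock + (D + u.length + 400) := by
  have hb := hO.le_word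
  have hyb := hO.fits_points y hy.1
  have hzb := hO.fits_points z hz.1
  refine terminates_block_cons ((terminates_computeWeights hp5.1 hq5.1 hp hq hyb hzb
    (w := w) (by omega)).imp ?_)
  rintro s1 ⟨⟨k, l, hk, hl, hk0, hl0, hkb, hlb, d, hd, hkd, hld⟩, r1, m1, o1, t1⟩
  have hS : I.S ≠ ∅ := by
    intro hS
    obtain ⟨x, hx, -⟩ := hy.1
    simp [hS] at hx
  refine terminates_block_cons ((terminates_solveLex hO
    (hs.congr (r1 _ (by simp [rN, rW₁]) (by simp [rN, rW₂])) fun _ _ => by rw [m1])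
    hk hl hk0 hl0 hkb hlb fun h => absurd h hS).imp ?_)
  rintro s2 ⟨hres, R2, r2, m2, o2, t2⟩
  obtain ⟨x, hx, -, hxZ⟩ := hres.resolve_left fun h => hS h.1
  obtain ⟨hxE, hnone, hbetween⟩ := hx.examine hy hz hyz hd (by simpa using hkd)
    (by simpa using hld)
  have hxb := hO.fits_points x hxE.1
  have hreg2 : ∀ r, Preserved r ∨ r = rTail → s2.reg r = s.reg r := by
    intro r hr
    simp only [Preserved, rTail] at hr
    rw [r2 r (by simp only [rZ]; omega),
      r1 r (by simp only [rW₁]; omega) (by simp only [rW₂]; omega)]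
  have hp2 := hp.preserved hp5 fun r hr => hreg2 r (.inl hr)
  have hq2 := hq.preserved hq5 fun r hr => hreg2 r (.inl hr)
  have hT2 : s2.reg rTail = T := by rw [hreg2 _ (.inr rfl), hT]
  have hm2 : ∀ i, u.length + 10 ≤ i → s2.mem i = s.mem i := fun i hi => by
    rw [m2 i hi, m1]
  obtain ⟨f1, g1, n1, e1⟩ := different_spec (w := w) hxZ hp2 hxb hyb (by omega)
  obtain ⟨f2, g2, n2, e2⟩ := different_spec (w := w) hxZ hq2 hxb hzb (by omega)
  -- Two factors of `2 * b + 5` bits each; this is the origin of `4 * b + 10` in `Oracle.le_word`.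
  have hfits : (different rZ p * different rZ q).Fits w s2 :=
    ⟨f1, f2, (g1.mul g2).mono (by omega)⟩
  have hcost : (different rZ p * different rZ q).cost = 63 := rfl
  refine terminates_block_cons (terminates_ite hfits ?_ ?_)
  · intro hpos
    rw [eval_mul] at hpos
    have h1 := e1.1 (lt_of_le_of_ne n1 fun h => by simp [← h] at hpos)
    have h2 := e2.1 (lt_of_le_of_ne n2 fun h => by simp [← h] at hpos)
    refine (terminates_enqueue (s := s2.tick _) hp2 hq2 hxZ hxb hyb hzb (by omega) hT2 hTw).imp ?_
    rintro s3 ⟨h3, T3, r3, m3, o3, t3⟩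
    refine terminates_block_nil
      ⟨.inr ⟨x, hxE, hbetween h1 h2, T3, h3⟩, R2.congr ?_ ?_, ?_, ?_, ?_, ?_⟩
    · rw [r3 _ (by simp [rN, rTail])]; rfl
    · intro i hi
      rw [m3 i (by omega)]; rfl
    · intro r hr
      rw [r3 r (by simp only [Preserved] at hr; simp only [rTail]; omega)]
      exact hreg2 r (.inl hr)
    · intro i h1 h2
      rw [m3 i h2]
      exact hm2 i h1
    · rw [o3, State.out_tick, o2, o1]
    · rw [State.clock_tick] at t3
      omega
  · intro hneg
    refine terminates_skip (terminates_block_nil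
      ⟨.inl ⟨hT2, hnone ?_⟩, R2.congr rfl fun _ _ => rfl, ?_, fun i h1 _ => hm2 i h1, ?_, ?_⟩)
    · by_contra! h
      exact hneg (mul_pos (e1.2 h.1) (e2.2 h.2))
    · exact fun r hr => hreg2 r (.inl hr)
    · rw [State.out_tick, o2, o1]
    · rw [State.clock_tick]
      omega

end Dichotomic

/-! ### The main loop -/

namespace BOCOInstance

variable {I : BOCOInstance}

/-- A nondominated extreme point `y` between `p` and `q` splits the points between `p` and `q`. -/
theorem between_split {p q y z : Fin 2 → ℚ} (hy : y ∈ I.extremes) (hz : z ∈ I.extremes)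
    (hpqy : Between p q y) :
    (if Between p q z then 1 else 0) =
      (if y = z then 1 else 0) + (if Between y p z then 1 else 0) +
        (if Between y q z then 1 else 0) := by
  -- Extreme points are determined by their first coordinates, so only the order of four rational
  -- numbers matters.
  have hyz : y = z ↔ y 0 = z 0 := ⟨fun h => h ▸ rfl, eq_of_fst_eq hy hz⟩
  simp only [Between, hyz] at *
  rcases lt_trichotomy (y 0) (z 0) with h | h | h <;> grind

end BOCOInstance

namespace Dichotomic

open RAM RAM.Exp RAM.Program

/-- Every output was written at most `E` steps after the previous one (or the start), and at most
`d` steps have been made since the last one. -/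
def Timed (E d : ℕ) (s : State) : Prop :=
  List.IsChain (fun a b => b ≤ a + E) ([0] ++ s.out.map Prod.snd) ∧
    ∀ c ∈ ([0] ++ s.out.map Prod.snd).getLast?, s.clock ≤ c + d

section Timed

variable {E d d' e : ℕ} {s t : State}

theorem Timed.step (h : Timed E d s) (ho : t.out = s.out) (hc : t.clock ≤ s.clock + e)
    (hd : d + e ≤ d') : Timed E d' t := by
  refine ⟨by rw [ho]; exact h.1, fun c hc' => ?_⟩
  rw [ho] at hc'
  have := h.2 c hc'
  omega

theorem Timed.isChain (h : Timed E d s) (hd : d ≤ E) {c : ℕ} (hc : c ≤ s.clock + (E - d)) :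
    List.IsChain (fun a b => b ≤ a + E) ([0] ++ s.out.map Prod.snd ++ [c]) := by
  rw [List.isChain_append]
  refine ⟨h.1, List.isChain_singleton _, fun a ha b hb => ?_⟩
  have := h.2 a ha
  simp only [List.head?_cons, Option.mem_def, Option.some.injEq] at hb
  omega

/-- An output resets the time elapsed since the last output to 0. -/
theorem Timed.output (h : Timed E d s) (hd : d + e ≤ E) (v : List ℤ) :
    Timed E 0 { s with clock := s.clock + e, out := s.out ++ [(v, s.clock + e)] } := by
  constructor
  · simpa using h.isChain (c := s.clock + e) (by omega) (by omega)
  · intro c hc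
    rw [List.map_append, ← List.append_assoc, List.map_singleton, List.getLast?_concat,
      Option.mem_def, Option.some.injEq] at hc
    simp [← hc]

end Timed

variable {w b : ℕ} {I : BOCOInstance} {A : Program} {u : List ℤ} {D E d : ℕ} {s : State}

/-- The state of the algorithm when the points in `L` have been written, the triples in `Q` are in
the queue, and the pairs in `R` are still to be examined: every nondominated extreme point is
either in `L` or lies in exactly one of the gaps described by `Q` and `R`. -/
structure Inv (I : BOCOInstance) (u : List ℤ) (E d : ℕ) (s : State) (L : List (Fin 2 → ℚ))
    (Q : List Triple) (R : List ((Fin 2 → ℚ) × (Fin 2 → ℚ))) : Prop where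
  ready : Ready u s
  queue : ∃ H : ℕ, u.length + 10 ≤ H ∧ s.reg rHead = H ∧
    s.reg rTail = (H + 12 * Q.length : ℕ) ∧ HasQueue s.mem H Q ∧
    H + 12 * (Q.length + R.length) ≤ u.length + 10 + 24 * L.length
  count : ∀ z ∈ I.extremes, L.count z + Q.countP (fun t => Between t.2.1 t.2.2 z) +
    R.countP (fun t => Between t.1 t.2 z) = 1
  outputs : ∀ y ∈ L, y ∈ I.extremes
  triples : ∀ t ∈ Q, t.1 ∈ I.extremes ∧ t.2.1 ∈ I.extremes ∧ t.2.2 ∈ I.extremes ∧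
    Between t.2.1 t.2.2 t.1
  pairs : ∀ t ∈ R, t.1 ∈ I.extremes ∧ t.2 ∈ I.extremes ∧ t.1 ≠ t.2
  out : s.out.map Prod.fst = L.map codePoint
  timed : Timed E d s

section Inv

variable {L : List (Fin 2 → ℚ)} {Q : List Triple} {R : List ((Fin 2 → ℚ) × (Fin 2 → ℚ))}

theorem Inv.nodup (h : Inv I u E d s L Q R) : L.Nodup := by
  rw [List.nodup_iff_count_le_one]
  intro z
  by_cases hz : z ∈ L
  · have := h.count z (h.outputs z hz)
    omega
  · rw [List.count_eq_zero_of_not_mem hz]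
    exact Nat.zero_le _

theorem Inv.length_le (h : Inv I u E d s L Q R) : L.length ≤ 2 ^ I.n :=
  length_le_of_nodup h.nodup h.outputs

theorem Inv.mem_iff (h : Inv I u E d s L [] []) (z : Fin 2 → ℚ) : z ∈ L ↔ z ∈ I.extremes := by
  refine ⟨h.outputs z, fun hz => ?_⟩
  have := h.count z hz
  rw [← List.count_pos_iff]
  simp at this
  omega

/-- Either the gap `(y, z)` is empty and may be dropped, or it moves unchanged from the pending
pairs to the queue, now with a witness inside it. Both moves preserve the count. The address bound
charges 12 cells to a pending pair already, so it survives too. -/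
theorem Inv.examine (hO : Oracle I A u w b D) {p q : ℕ} {y z : Fin 2 → ℚ}
    (h : Inv I u E d s L Q ((y, z) :: R)) (hp5 : 5 ≤ p ∧ p < 37) (hq5 : 5 ≤ q ∧ q < 37)
    (hp : HasPoint s.reg p y) (hq : HasPoint s.reg q z) :
    Terminates w (examine A p q) s fun t =>
      (∃ Q', Inv I u E (d + (D + u.length + 400)) t L Q' R) ∧
        ∀ r, Preserved r → t.reg r = s.reg r := by
  obtain ⟨H, hH, hhead, htail, hqueue, hbound⟩ := h.queue
  obtain ⟨hy, hz, hyz⟩ := h.pairs _ List.mem_cons_self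
  have hlen := h.length_le
  have haddr := hO.addr_lt
  simp only [List.length_cons] at hbound
  refine (terminates_examine hO h.ready hp5 hq5 hp hq hy hz hyz htail (by omega)
    (by omega)).imp ?_
  rintro t ⟨hres, hready, hreg, hmem, hout, hclock⟩
  have hqueue' : HasQueue t.mem H Q := hqueue.congr fun i hi hi' => hmem i (by omega) hi'
  have hhead' : t.reg rHead = H := by rw [hreg _ (.inl (by simp [rHead])), hhead]
  have htimed : Timed E (d + (D + u.length + 400)) t := h.timed.step hout hclock le_rfl
  have hout' : t.out.map Prod.fst = L.map codePoint := by rw [hout, h.out]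
  have hpairs : ∀ t ∈ R, t.1 ∈ I.extremes ∧ t.2 ∈ I.extremes ∧ t.1 ≠ t.2 := fun t ht =>
    h.pairs t (List.mem_cons_of_mem _ ht)
  refine ⟨?_, hreg⟩
  rcases hres with ⟨hT, hnone⟩ | ⟨x, hx, hbetween, hT, htriple⟩
  · refine ⟨Q, hready, ⟨H, hH, hhead', hT, hqueue', by omega⟩, fun v hv => ?_, h.outputs,
      h.triples, hpairs, hout', htimed⟩
    have := h.count v hv
    rwa [List.countP_cons_of_neg (by simpa using hnone v hv)] at this
  · refine ⟨Q ++ [(x, y, z)], hready, ⟨H, hH, hhead', ?_, hqueue'.append htriple, ?_⟩,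
      fun v hv => ?_, h.outputs, ?_, hpairs, hout', htimed⟩
    · rw [hT, List.length_append, List.length_singleton, mul_add, add_assoc]
    · rw [List.length_append, List.length_singleton]
      omega
    · rw [← h.count v hv]
      simp only [List.countP_append, List.countP_cons, List.countP_nil]
      omega
    · intro t ht
      rcases List.mem_append.1 ht with ht | ht
      · exact h.triples t ht
      · rw [List.mem_singleton.1 ht]
        exact ⟨hx, hy, hz, hbetween⟩

/-- The output comes before the two examinations. The slack of 200 covers the steps up to the
output, and afterwards the elapsed time is that of two examinations, whatever `d` was. -/
theorem Inv.iteration (hO : Oracle I A u w b D) {x : Triple}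
    (h : Inv I u E d s L (x :: Q) []) (hd : d + 200 ≤ E) :
    Terminates w (iteration A) s fun t =>
      ∃ L' Q', L'.length = L.length + 1 ∧ Inv I u E (2 * (D + u.length + 400)) t L' Q' [] := by
  obtain ⟨H, hH, hhead, htail, hqueue, hbound⟩ := h.queue
  obtain ⟨y, p, q⟩ := x
  obtain ⟨⟨hy, hp, hq⟩, hqueue⟩ := hqueue.tail
  obtain ⟨hyE, hpE, hqE, hbetween⟩ := h.triples _ List.mem_cons_self
  simp only [List.length_cons, List.length_nil, add_zero] at hbound htail
  dsimp only at hy hp hq hyE hpE hqE hbetween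
  have hlen := h.length_le
  have haddr := hO.addr_lt
  have hbw : b ≤ w := by have := hO.le_word; omega
  have hyb := hO.fits_points y hyE.1
  have hpb := hO.fits_points p hpE.1
  have hqb := hO.fits_points q hqE.1
  have addr : ∀ (i : ℕ) (t : State), t.reg rHead = s.reg rHead → i < 20 →
      (reg rHead + .const i).Fits w t ∧ (reg rHead + .const i).eval t = (H + i : ℕ) := by
    intro i t hreg hi
    have hc : (Exp.const i).eval t = i := rfl
    simp only [fits_add, eval_add, hc, fits_reg, eval_reg, hreg, hhead]
    refine ⟨⟨?_, (fitsWord_natCast.2 (by omega) : FitsWord w i), ?_⟩, by push_cast; rfl⟩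
    · rw [fitsWord_natCast]; omega
    · rw [← Nat.cast_add, fitsWord_natCast]; omega
  refine terminates_block_cons ((terminates_loadPoint (k := H) ?_ (by omega) (by simp)
    (hy.fits hyb hbw)).imp ?_)
  · intro t ht
    have := ht rHead (by simp [rHead, rY])
    simp only [fits_reg, eval_reg, this, hhead, fitsWord_natCast]
    exact ⟨by omega, trivial⟩
  rintro s1 ⟨p1, r1, m1, o1, t1⟩
  have hh1 : s1.reg rHead = s.reg rHead := r1 _ (by simp [rHead, rY])
  refine terminates_block_cons ((terminates_loadPoint (k := H + 4)
    (fun t ht => addr 4 t ((ht rHead (by simp [rHead, rY₂])).trans hh1) (by norm_num))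
    (by omega) (by simp [Exp.cost]) ?_).imp ?_)
  · rw [m1]
    exact hp.fits hpb hbw
  rintro s2 ⟨p2, r2, m2, o2, t2⟩
  rw [m1] at m2 p2
  have hh2 : s2.reg rHead = s.reg rHead := (r2 _ (by simp [rHead, rY₂])).trans hh1
  refine terminates_block_cons ((terminates_loadPoint (k := H + 8)
    (fun t ht => addr 8 t ((ht rHead (by simp [rHead, rY₃])).trans hh2) (by norm_num))
    (by omega) (by simp [Exp.cost]) ?_).imp ?_)
  · rw [m2]
    exact hq.fits hqb hbw
  rintro s3 ⟨p3, r3, m3, o3, t3⟩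
  rw [m2] at m3 p3
  have hh3 : s3.reg rHead = s.reg rHead := (r3 _ (by simp [rHead, rY₃])).trans hh2
  have a4 := addr 12 s3 hh3 (by norm_num)
  refine terminates_block_cons (terminates_assign_eq a4.1 a4.2 ?_)
  intro s4 r4 m4 o4 t4
  have hreg4 : ∀ r, r ≠ rHead → r < 10 → s4.reg r = s.reg r := by
    intro r hr hr'
    rw [r4, Function.update_of_ne hr, r3 r (.inl (by simp only [rY₃]; omega)),
      r2 r (.inl (by simp only [rY₂]; omega)), r1 r (.inl (by simp only [rY]; omega))]
  have hy4 : HasPoint s4.reg rY y := by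
    refine hy.congr fun j hj => ?_
    rw [r4, Function.update_of_ne (by simp only [rY, rHead]; omega),
      r3 _ (.inl (by simp only [rY, rY₃]; omega)), r2 _ (.inl (by simp only [rY, rY₂]; omega)),
      p1 j hj]
  have hp4 : HasPoint s4.reg rY₂ p := by
    refine hp.congr fun j hj => ?_
    rw [r4, Function.update_of_ne (by simp only [rY₂, rHead]; omega),
      r3 _ (.inl (by simp only [rY₂, rY₃]; omega)), p2 j hj]
  have hq4 : HasPoint s4.reg rY₃ q := by
    refine hq.congr fun j hj => ?_
    rw [r4, Function.update_of_ne (by simp only [rY₃, rHead]; omega), p3 j hj]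
  have hout4 : s4.out = s.out := by rw [o4, o3, o2, o1]
  have hclock4 : s4.clock ≤ s.clock + 130 := by
    simp [Exp.cost] at t4
    omega
  refine terminates_block_cons (terminates_outputPoint (hy4.fits hyb hbw) hy4 ?_)
  set s5 : State := { s4 with
    clock := s4.clock + 5, out := s4.out ++ [(codePoint y, s4.clock + 5)] } with hs5
  have hne : ∀ v, Between p q v → v ≠ p ∧ v ≠ q := by
    rintro v hv
    constructor <;> rintro rfl <;> simp only [Between] at hv <;> grind
  -- By `between_split`, trading the gap `(p, q)` for the output `y` and two smaller gaps keeps the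
  -- count. The head advances by 12 and the number of queued or pending gaps grows by one, which
  -- together use the 24 cells granted by the new output.
  have h5 : Inv I u E 0 s5 (L ++ [y]) Q [(y, p), (y, q)] := by
    refine ⟨h.ready.congr (hreg4 _ (by simp [rN, rHead]) (by simp [rN])) fun i _ => ?_,
      ⟨H + 12, by omega, ?_, ?_, ?_, ?_⟩, fun v hv => ?_, ?_, ?_, ?_, ?_, ?_⟩
    · exact congrFun (m4.trans m3) i
    · change s4.reg rHead = _
      rw [r4, Function.update_self]
    · change s4.reg rTail = _
      rw [hreg4 _ (by simp [rTail, rHead]) (by simp [rTail]), htail, mul_add, add_assoc,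
        add_comm (12 * _)]
    · change HasQueue s4.mem _ _
      rwa [m4, m3]
    · simp only [List.length_append, List.length_cons, List.length_nil]
      omega
    · have hsplit := between_split hyE hv hbetween
      have := h.count v hv
      simp only [List.countP_cons, List.countP_nil, List.count_append, List.count_cons,
        List.count_nil, decide_eq_true_eq, beq_iff_eq] at this ⊢
      omega
    · intro v hv
      rcases List.mem_append.1 hv with hv | hv
      · exact h.outputs v hv
      · rwa [List.mem_singleton.1 hv]
    · exact fun t ht => h.triples t (List.mem_cons_of_mem _ ht)
    · simp only [List.mem_cons, List.not_mem_nil, or_false, forall_eq_or_imp, forall_eq]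
      exact ⟨⟨hyE, hpE, (hne y hbetween).1⟩, hyE, hqE, (hne y hbetween).2⟩
    · simp [hs5, hout4, h.out]
    · exact (h.timed.step hout4 hclock4 le_rfl).output (by omega) _
  refine terminates_block_cons ((h5.examine hO (by simp [rY]) (by simp [rY₂]) hy4 hp4).imp ?_)
  rintro s6 ⟨⟨Q', h6⟩, r6⟩
  refine terminates_block_cons ((h6.examine hO (by simp [rY]) (by simp [rY₃])
    (hy4.preserved (by simp [rY]) r6) (hq4.preserved (by simp [rY₃]) r6)).imp ?_)
  rintro s7 ⟨⟨Q'', h7⟩, -⟩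
  refine terminates_block_nil ⟨L ++ [y], Q'', by simp, ?_⟩
  rwa [zero_add, ← two_mul] at h7

theorem Inv.step {t : State} {e d' : ℕ} (h : Inv I u E d s L Q R) (hr : t.reg = s.reg)
    (hm : t.mem = s.mem) (ho : t.out = s.out) (hc : t.clock ≤ s.clock + e) (hd : d + e ≤ d') :
    Inv I u E d' t L Q R := by
  obtain ⟨H, hH, hhead, htail, hqueue, hbound⟩ := h.queue
  exact ⟨h.ready.congr (by rw [hr]) fun _ _ => by rw [hm],
    ⟨H, hH, by rw [hr, hhead], by rw [hr, htail], by rwa [hm], hbound⟩, h.count, h.outputs,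
    h.triples, h.pairs, by rw [ho, h.out], h.timed.step ho hc hd⟩

/-- Induction on `2 ^ I.n - L.length`, which drops in each iteration since the output list stays
duplicate-free. The elapsed-time bound returns to the same value after every iteration, so the delay
does not accumulate. -/
theorem Inv.loop (hO : Oracle I A u w b D) (hE : E = 2 * (D + u.length + 400) + 1000)
    (h : Inv I u E (2 * (D + u.length + 400)) s L Q []) :
    Terminates w (loop (reg rTail - reg rHead) (Dichotomic.iteration A)) s fun t =>
      ∃ L', Inv I u E E t L' [] [] := by
  induction hm : 2 ^ I.n - L.length using Nat.strong_induction_on generalizing s L Q with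
  | _ m ih =>
  obtain ⟨H, hH, hhead, htail, hqueue, hbound⟩ := h.queue
  have hlen := h.length_le
  have haddr := hO.addr_lt
  have hval : (reg rTail - reg rHead).eval s = (12 * Q.length : ℕ) := by
    simp [hhead, htail]
  refine terminates_loop ?_ ?_ ?_
  · simp only [fits_sub, fits_reg, eval_reg]
    rw [show s.reg rTail - s.reg rHead = (reg rTail - reg rHead).eval s from rfl, hval, hhead,
      htail, fitsWord_natCast, fitsWord_natCast, fitsWord_natCast]
    simp only [List.length_nil] at hbound
    omega
  · intro hpos
    cases Q with
    | nil => simp [hval] at hpos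
    | cons x Q =>
      have h' : Inv I u E (2 * (D + u.length + 400) + 4) (s.tick 4) L (x :: Q) [] :=
        h.step rfl rfl rfl le_rfl le_rfl
      refine (h'.iteration hO (by omega)).imp ?_
      rintro t ⟨L', Q', hL', ht⟩
      have := ht.length_le
      exact ih _ (by omega) ht rfl
  · intro hneg
    cases Q with
    | nil => exact ⟨L, h.step rfl rfl rfl le_rfl (by simp; omega)⟩
    | cons x Q => simp [hval] at hneg

end Inv

end Dichotomic

/-! ### The variant of the Dichotomic Approach -/

namespace Dichotomic

open RAM RAM.Exp RAM.Program

variable {w b : ℕ} {I : BOCOInstance} {A : Program} {u : List ℤ} {D E d : ℕ} {s : State}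

theorem timed_start (u : List ℤ) (E : ℕ) : Timed E 0 (State.start u) :=
  ⟨List.isChain_singleton _, fun _ _ => Nat.zero_le _⟩

/-- All nondominated extreme points have been written, each of them once. -/
def Enumerated (I : BOCOInstance) (E : ℕ) (t : State) : Prop :=
  ∃ L : List (Fin 2 → ℚ), L.Nodup ∧ (∀ z, z ∈ L ↔ z ∈ I.extremes) ∧
    t.out.map Prod.fst = L.map codePoint ∧ Timed E E t

theorem terminates_setup (hO : Oracle I A u w b D) {cs : List Program} {Q : State → Prop}
    (h : ∀ s, Ready u s → s.reg rHead = (u.length + 10 : ℕ) →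
      s.reg rTail = (u.length + 10 : ℕ) → s.reg rW₁ = 1 → s.reg rW₂ = 0 →
      (∀ j < 4, s.mem (u.length + 6 + j) = 0) → s.out = [] → s.clock ≤ 30 →
      Terminates w (block cs) s Q) :
    Terminates w (block (assign rN (load 0) :: store 0 (reg rN + 4) ::
      assign rHead (reg rN + 10) :: assign rTail (reg rN + 10) ::
      assign rW₁ 1 :: assign rW₂ 0 :: cs)) (State.start u) Q := by
  have haddr := hO.addr_lt
  have small : ∀ i : ℕ, i < 100 → FitsWord w i := fun i hi => fitsWord_natCast.2 (by omega)
  have addr : ∀ (i : ℕ) (t : State), t.reg rN = u.length → i < 100 →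
      (reg rN + .const i).Fits w t ∧ (reg rN + .const i).eval t = (u.length + i : ℕ) := by
    intro i t hreg hi
    have hc : (Exp.const i).eval t = i := rfl
    simp only [fits_add, eval_add, hc, fits_reg, eval_reg, hreg]
    refine ⟨⟨hO.fits_input.1, small i hi, ?_⟩, by push_cast; rfl⟩
    rw [← Nat.cast_add, fitsWord_natCast]; omega
  have hmem : (State.start u).mem 0 = u.length := writeBlock_self (fun _ => 0) 0 u
  refine terminates_block_cons (terminates_assign_eq (z := u.length) ?_ hmem ?_)
  · refine ⟨small 0 (by norm_num), ?_⟩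
    rw [show (Exp.eval (State.start u) 0).toNat = 0 from rfl, hmem]
    exact hO.fits_input.1
  intro s1 r1 m1 o1 t1
  have n1 : s1.reg rN = u.length := by rw [r1, Function.update_self]
  have a1 := addr 4 s1 n1 (by norm_num)
  refine terminates_block_cons (terminates_store_eq (k := 0) (small 0 (by norm_num)) rfl
    a1.1 a1.2 ?_)
  intro s2 m2 r2 o2 t2
  have n2 : s2.reg rN = u.length := by rw [r2, n1]
  have a2 := addr 10 s2 n2 (by norm_num)
  refine terminates_block_cons (terminates_assign_eq a2.1 a2.2 ?_)
  intro s3 r3 m3 o3 t3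
  have n3 : s3.reg rN = u.length := by rw [r3, Function.update_of_ne (by simp [rN, rHead]), n2]
  have a3 := addr 10 s3 n3 (by norm_num)
  refine terminates_block_cons (terminates_assign_eq a3.1 a3.2 ?_)
  intro s4 r4 m4 o4 t4
  refine terminates_block_cons (terminates_assign_eq (z := 1) (small 1 (by norm_num)) rfl ?_)
  intro s5 r5 m5 o5 t5
  refine terminates_block_cons (terminates_assign_eq (z := 0) (small 0 (by norm_num)) rfl ?_)
  intro s6 r6 m6 o6 t6
  have hm : ∀ i, i ≠ 0 → s6.mem i = (State.start u).mem i := fun i hi => by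
    rw [m6, m5, m4, m3, m2, Function.update_of_ne hi, m1]
  refine h s6 ⟨?_, ?_, fun i hi => ?_⟩ ?_ ?_ ?_ ?_ (fun j _ => ?_) ?_ ?_
  · simp [r6, r5, r4, rN, rTail, rW₁, rW₂]
    exact n3
  · rw [m6, m5, m4, m3, m2, Function.update_self]
  · rw [hm _ (by omega), show 1 + i = 0 + 1 + i by omega]
    exact writeBlock_add (fun _ => 0) 0 u hi
  · simp [r6, r5, r4, r3, rHead, rTail, rW₁, rW₂]
  · simp [r6, r5, r4, rTail, rW₁, rW₂]
  · simp [r6, r5, rW₁, rW₂]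
  · simp [r6]
  · rw [hm _ (by omega)]
    exact writeBlock_of_gt (fun _ => 0) (a := 0) u (by omega)
  · rw [o6, o5, o4, o3, o2, o1]
    rfl
  · have : (State.start u).clock = 0 := rfl
    simp [Exp.cost] at t1 t2 t3 t4 t5 t6
    omega

theorem terminates_variant (hO : Oracle I A u w b D)
    (hE : E = 2 * (D + u.length + 400) + 1000) :
    Terminates w (variant A) (State.start u) (Enumerated I E) := by
  have haddr := hO.addr_lt
  have hb := hO.le_word
  have hb1 := hO.one_le
  have small : ∀ i : ℕ, i < 100 → FitsWord w i := fun i hi => fitsWord_natCast.2 (by omega)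
  have fits0 : FitsWord (4 * b + 1) 0 := by simp [FitsWord]
  have fits1 : FitsWord (4 * b + 1) 1 := by
    simp only [FitsWord, Int.natAbs_one]
    exact Nat.one_lt_two_pow (by omega)
  refine terminates_setup hO ?_
  intro s1 R1 head1 tail1 k1 l1 z1 o1 t1
  refine terminates_block_cons ((terminates_solveLex hO R1 k1 l1 zero_le_one le_rfl fits1 fits0
    fun _ => z1).imp ?_)
  rintro s2 ⟨res2, R2, r2, m2, o2, t2⟩
  have hcell : FitsWord w (s2.mem (u.length + 5)) := by
    rcases res2 with ⟨-, h⟩ | ⟨-, -, h, -⟩ <;> rw [h]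
    exacts [small 0 (by norm_num), small 4 (by norm_num)]
  have hfeas : feasible.eval s2 = s2.mem (u.length + 5) := by
    simp only [feasible, eval_load, eval_add, eval_reg, R2.reg_rN, eval_ofNat]
    congr 1
  have hfeasFits : feasible.Fits w s2 := by
    refine ⟨?_, by rw [← hfeas] at hcell; exact hcell⟩
    simp only [fits_add, fits_reg, eval_reg, R2.reg_rN, fits_ofNat, eval_ofNat]
    refine ⟨hO.fits_input.1, small 5 (by norm_num), ?_⟩
    rw [← Nat.cast_add, fitsWord_natCast]; omega
  refine terminates_block_cons (terminates_ite hfeasFits ?_ ?_)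
  swap
  · intro hneg
    have hS : I.S = ∅ := by
      rcases res2 with h | ⟨-, -, h, -⟩
      · exact h.1
      · simp [hfeas, h] at hneg
    refine terminates_skip (terminates_block_nil ⟨[], List.nodup_nil, fun z => ?_, ?_, ?_⟩)
    · simp only [List.not_mem_nil, false_iff]
      rintro ⟨⟨x, hx, -⟩, -⟩
      simp [hS] at hx
    · rw [State.out_tick, o2, o1]
      rfl
    -- Without any output, the whole running time must be at most `E`.
    · refine (timed_start u E).step (e := E) (by rw [State.out_tick, o2, o1]; rfl) ?_ (by omega)
      rw [State.clock_tick, show feasible.cost = 4 from rfl]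
      omega
  intro hpos
  rw [hfeas] at hpos
  obtain ⟨y, hy, -, hyZ⟩ := res2.resolve_left fun h => by simp [h.2] at hpos
  rw [Int.cast_one, Int.cast_zero] at hy
  have hS : I.S ≠ ∅ := by
    intro hS
    obtain ⟨x, hx, -⟩ := hy.1
    simp [hS] at hx
  have hyE : y ∈ I.extremes := hy.mem_extremes fun i => by fin_cases i <;> simp
  have hyb := hO.fits_points y hy.1
  refine terminates_block_cons ((terminates_copyPoint (s := s2.tick _) (p := rY₂) (q := rZ) (by simp [rY₂, rZ])
    (hyZ.fits hyb (by omega : b ≤ w))).imp ?_)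
  rintro s3 ⟨p3, r3, m3, o3, t3⟩
  refine terminates_block_cons (terminates_assign_eq (z := 0) (small 0 (by norm_num)) rfl ?_)
  intro s4 r4 m4 o4 t4
  refine terminates_block_cons (terminates_assign_eq (z := 1) (small 1 (by norm_num)) rfl ?_)
  intro s5 r5 m5 o5 t5
  have hlow : ∀ r < 3, s5.reg r = s2.reg r := fun r hr => by
    rw [r5, Function.update_of_ne (by simp only [rW₂]; omega), r4,
      Function.update_of_ne (by simp only [rW₁]; omega), r3 r (.inl (by simp only [rY₂]; omega))]
    rfl
  have R5 : Ready u s5 := R2.congr (hlow _ (by simp [rN])) fun i _ => by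
    rw [m5, m4, m3]; rfl
  refine terminates_block_cons ((terminates_solveLex hO R5 (k := 0) (l := 1)
    (by rw [r5, Function.update_of_ne (by simp [rW₁, rW₂]), r4, Function.update_self])
    (by rw [r5, Function.update_self]) le_rfl zero_le_one fits0 fits1 fun h => absurd h hS).imp ?_)
  rintro s6 ⟨res6, R6, r6, m6, o6, t6⟩
  obtain ⟨z, hz, -, hzZ⟩ := res6.resolve_left fun h => hS h.1
  rw [Int.cast_one, Int.cast_zero] at hz
  have hzE : z ∈ I.extremes := hz.mem_extremes fun i => by fin_cases i <;> simp
  have hzb := hO.fits_points z hz.1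
  refine terminates_block_cons ((terminates_copyPoint (p := rY₃) (q := rZ) (by simp [rY₃, rZ])
    (hzZ.fits hzb (by omega : b ≤ w))).imp ?_)
  rintro s7 ⟨p7, r7, m7, o7, t7⟩
  have hz7 : HasPoint s7.reg rY₃ z := hzZ.congr p7
  have hy7 : HasPoint s7.reg rY₂ y := by
    refine hyZ.congr fun j hj => ?_
    rw [r7 _ (.inl (by simp only [rY₂, rY₃]; omega)), r6 _ (.inl (by simp only [rY₂, rZ]; omega)),
      r5, Function.update_of_ne (by simp only [rY₂, rW₂]; omega), r4,
      Function.update_of_ne (by simp only [rY₂, rW₁]; omega), p3 j hj]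
    rfl
  have hout7 : s7.out = [] := by
    rw [o7, o6, o5, o4, o3, State.out_tick, o2, o1]
  have hclock7 : s7.clock ≤ 2 * (D + u.length + 400) := by
    rw [State.clock_tick, show feasible.cost = 4 from rfl] at t3
    simp at t4 t5
    omega
  have hlow7 : ∀ r < 3, s7.reg r = s1.reg r := fun r hr => by
    rw [r7 r (.inl (by simp only [rY₃]; omega)), r6 r (.inl (by simp only [rZ]; omega)), hlow r hr,
      r2 r (.inl (by simp only [rZ]; omega))]
  have R7 : Ready u s7 := R6.congr (r7 _ (.inl (by simp [rN, rY₃]))) fun i _ => by rw [m7]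
  have T7 : Timed E (2 * (D + u.length + 400)) s7 :=
    (timed_start u E).step (by rw [hout7]; rfl) (hclock7.trans (Nat.le_add_left _ _)) (by omega)
  refine terminates_block_cons (terminates_outputPoint (hy7.fits hyb (by omega)) hy7 ?_)
  have T8 := T7.output (e := 5) (by omega) (codePoint y)
  set s8 : State := { s7 with
    clock := s7.clock + 5, out := s7.out ++ [(codePoint y, s7.clock + 5)] } with hs8
  obtain ⟨f, -, -, hdiff⟩ := different_spec (s := s8) (w := w) hy7 hz7 hyb hzb (by omega)
  have hcost : (different rY₂ rY₃).cost = 31 := rfl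
  have T9 : Timed E 32 (s8.tick ((different rY₂ rY₃).cost + 1)) :=
    T8.step rfl (by rw [State.clock_tick, hcost]) le_rfl
  refine terminates_block_cons (terminates_ite f ?_ ?_)
  swap
  · intro hneg
    have hyz : y = z := by
      by_contra h
      exact hneg (hdiff.2 h)
    subst hyz
    refine terminates_skip (terminates_block_nil (terminates_block_nil
      ⟨[y], List.nodup_singleton y, fun v => ?_, ?_, T9.step (e := 0) rfl le_rfl (by omega)⟩))
    · rw [List.mem_singleton]
      refine ⟨fun h => h ▸ hyE, fun hv => ?_⟩
      rcases extremes_eq_or_between hy hz hv with h | h | h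
      · exact h
      · exact h
      · exact absurd (h.1.trans h.2) (lt_irrefl _)
    · simp [hs8, hout7]
  intro hpos'
  have hyz := hdiff.1 hpos'
  refine terminates_block_cons (terminates_outputPoint (s := s8.tick _)
    (hz7.fits hzb (by omega)) hz7 ?_)
  have T10 := T9.output (e := 5) (by omega) (codePoint z)
  set s10 : State := { s8.tick ((different rY₂ rY₃).cost + 1) with
    clock := (s8.tick ((different rY₂ rY₃).cost + 1)).clock + 5
    out := (s8.tick ((different rY₂ rY₃).cost + 1)).out ++
      [(codePoint z, (s8.tick ((different rY₂ rY₃).cost + 1)).clock + 5)] } with hs10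
  have hlt : ∀ v, v = y ∨ v = z → ¬ Between y z v := by
    rintro v (rfl | rfl) h <;> simp only [Between] at h <;> grind
  -- The invariant starts here: by `extremes_eq_or_between`, every extreme point is one of the two
  -- outputs or lies in the single pending gap, and `hlt` excludes both at once.
  have h10 : Inv I u E 0 s10 [y, z] [] [(y, z)] := by
    refine ⟨R7.congr rfl fun _ _ => rfl, ⟨u.length + 10, le_rfl, (hlow7 _ (by simp [rHead])).trans
      head1, (hlow7 _ (by simp [rTail])).trans tail1, fun i hi => absurd hi (by simp), ?_⟩,
      fun v hv => ?_, ?_, by simp, ?_, ?_, T10⟩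
    · simp only [List.length_cons, List.length_nil]
      omega
    · have hb := hlt v
      have hcases := extremes_eq_or_between hy hz hv
      have hbetween : y 0 < v 0 ∧ v 0 < z 0 → Between y z v := .inl
      simp only [List.countP_cons, List.countP_nil, List.count_cons,
        List.count_nil, decide_eq_true_eq, beq_iff_eq]
      grind
    · simp [hyE, hzE]
    · simp [hyE, hzE, hyz]
    · simp [hs10, hs8, hout7]
  refine terminates_block_cons ((h10.examine hO (by simp [rY₂]) (by simp [rY₃]) hy7 hz7).imp ?_)
  rintro s11 ⟨⟨Q, h11⟩, -⟩
  -- Only one examination has followed the last output, so the bound of two that the loop expects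
  -- holds a fortiori.
  refine terminates_block_cons (((h11.step rfl rfl rfl (e := 0) le_rfl (by omega)).loop hO hE).imp
    ?_)
  rintro t ⟨L, ht⟩
  exact terminates_block_nil (terminates_block_nil (terminates_block_nil
    ⟨L, ht.nodup, ht.mem_iff, ht.out, ht.timed⟩))

end Dichotomic

/-! ### The main theorem -/

theorem Polynomial.eval_le_eval_of_le (p : Polynomial ℕ) {a b : ℕ} (h : a ≤ b) :
    p.eval a ≤ p.eval b := by
  simp only [Polynomial.eval_eq_sum_range]
  gcongr

theorem fitsBlock_codeString {w : ℕ} (x : List Bool) (hw : x.length < 2 ^ w) (hw0 : w ≠ 0) :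
    RAM.FitsBlock w (codeString x) := by
  refine ⟨by simpa [codeString, RAM.fitsWord_natCast] using hw, fun z hz => ?_⟩
  have := Nat.one_lt_two_pow hw0
  obtain ⟨c, -, rfl⟩ := List.mem_map.1 hz
  unfold RAM.FitsWord
  split_ifs
  · simpa using this
  · simp

/-- A program that solves the lexicographic version of a problem in polynomial time is an oracle
on every instance. -/
theorem BOCOProblem.oracle {P : BOCOProblem} {A : RAM.Program} {p : Polynomial ℕ}
    (hp : ∀ x ∈ P.lang, ∀ ℓ : Fin 2 → ℚ, 0 ≤ ℓ → ∃ t : RAM.State,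
      RAM.RunsTo (p.eval ((P.inst x).size + encVec ℓ)) A (codeString x ++ codePoint ℓ) t ∧
      t.clock ≤ p.eval ((P.inst x).size + encVec ℓ) ∧
      (((P.inst x).S = ∅ ∧ t.result = []) ∨
        ∃ y, (P.inst x).IsLexOptimal ℓ y ∧ t.result = codePoint y))
    {x : List Bool} (hx : x ∈ P.lang) {w : ℕ}
    (hw : p.eval (9 * (P.inst x).size + 18) + x.length + 4 * (P.inst x).size + 20 ≤ w) :
    Dichotomic.Oracle (P.inst x) A (codeString x) w ((P.inst x).size + 1)
      (p.eval (9 * (P.inst x).size + 18)) := by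
  have hlen : (codeString x).length = x.length := by simp [codeString]
  have hpow : x.length + 100 + 24 * 2 ^ (P.inst x).n < 2 ^ w := by
    have hn : (P.inst x).n ≤ (P.inst x).size := Nat.le_add_right _ _
    have h1 : x.length < 2 ^ x.length := Nat.lt_two_pow_self
    -- The factor `2 ^ 7 = 128` exceeds `1 + 100 + 24`, the total of the coefficients to be
    -- absorbed.
    have h2 : 2 ^ (P.inst x).n * 2 ^ x.length * 2 ^ 7 ≤ 2 ^ w := by
      rw [← pow_add, ← pow_add]
      exact Nat.pow_le_pow_right two_pos (by omega)
    have h3 : 2 ^ (P.inst x).n ≤ 2 ^ (P.inst x).n * 2 ^ x.length :=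
      Nat.le_mul_of_pos_right _ (by positivity)
    have h4 : 2 ^ x.length ≤ 2 ^ (P.inst x).n * 2 ^ x.length :=
      Nat.le_mul_of_pos_left _ (by positivity)
    omega
  refine ⟨fun y hy i => BOCOInstance.fits_of_mem_points hy i,
    fitsBlock_codeString x (by omega) (by omega), by omega, by omega, by rwa [hlen], ?_⟩
  intro k l hk hl hkb hlb
  -- For `b = size + 1` the weights have `4 * size + 5` bits, hence encoding length at most `8 *
  -- size + 18`; adding the instance size gives `9 * size + 18`.
  have hle : p.eval ((P.inst x).size + encVec ![(k : ℚ), (l : ℚ)]) ≤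
      p.eval (9 * (P.inst x).size + 18) := by
    refine p.eval_le_eval_of_le ?_
    have := encVec_intCast_le hkb hlb
    omega
  obtain ⟨t, ht, hclock, hres⟩ := hp x hx ![(k : ℚ), (l : ℚ)] fun i => by
    fin_cases i
    · exact Int.cast_nonneg hk
    · exact Int.cast_nonneg hl
  refine ⟨t, ?_, hclock.trans hle, hres⟩
  rw [← codePoint_intCast]
  exact ht.2.mono (by omega)

/-- If the lexicographic version of a biobjective combinatorial optimization problem `P` is solved
in polynomial time by a program `A`, then the variant of the Dichotomic Approach that calls `A`
enumerates the nondominated extreme points of `P` with polynomial delay. -/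
theorem mainTheorem8 (P : BOCOProblem) (A : RAM.Program) (hA : P.SolvesLexInPolyTime A) :
    P.EnumeratesExtremePointsWithPolyDelay (Dichotomic.variant A) := by
  obtain ⟨p, hp⟩ := hA
  obtain ⟨K, hK⟩ := P.length_le
  -- One polynomial bounds both delay and word length. The delay `E = 2 * (D + N + 400) + 1000`
  -- accounts for every term except `4 * .X`, which gives words room for products of coordinates;
  -- `K` bounds the input length `N`.
  refine ⟨2 * p.comp (9 * .X + 18) + 2 * (.C K * (.X + 1)) + 4 * .X + 1800, fun x hx => ?_⟩
  have heval : (2 * p.comp (9 * .X + 18) + 2 * (.C K * (.X + 1)) + 4 * .X + 1800 :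
      Polynomial ℕ).eval (P.inst x).size = 2 * p.eval (9 * (P.inst x).size + 18) +
        2 * (K * ((P.inst x).size + 1)) + 4 * (P.inst x).size + 1800 := by
    simp
  rw [heval]
  have hlen := hK x hx
  have hO := BOCOProblem.oracle hp hx (w := 2 * p.eval (9 * (P.inst x).size + 18) +
    2 * (K * ((P.inst x).size + 1)) + 4 * (P.inst x).size + 1800) (by omega)
  obtain ⟨t, ht, L, hL, hmem, hout, htimed⟩ := Dichotomic.terminates_variant hO rfl
  refine ⟨t, ⟨hO.fits_input, ht⟩, ⟨L, hL, ?_, hout⟩, ?_⟩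
  · rw [← BOCOInstance.image_extremes]
    exact congrArg _ (Set.ext hmem)
  · refine (htimed.isChain le_rfl (Nat.le_add_right _ _)).imp fun a b hab => hab.trans ?_
    rw [show (codeString x).length = x.length by simp [codeString]]
    omega
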